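/- **Setting.** A charge vector is $q=(q_1,\dots,q_n)\in\mathbb Q^n$ with $0<q_i<\tfrac12$. Its family consists of the polynomials $W\in\mathbb C[X_1,\dots,X_n]$ all of whose monomials $\prod X_i^{p_i}$ satisfy $\sum_i p_iq_i=1$. A polynomial $W$ is *compact* if $0$ is the only common zero in $\mathbb C^n$ of its partial derivatives; the family is *generically compact* (gc) if $W$ is compact for generic coefficients (outside the zero set of a nonzero polynomial in the coefficients). The central charge is $c=3\sum_i(1-2q_i)$. A gc family is *decomposable* if it has a compact member $W=W_1+W_2$ with $W_1,W_2$ polynomials in complementary nonempty sets of variables. In $W$, a variable $X_i$ is a *root* with exponent $m_i$ if $W$ contains $X_i^{m_i}$; if it is not a root, it is a *pointer* at $X_j$ $(j\ne i)$ with exponent $m_i$ if $W$ contains $X_i^{m_i}X_j$. A *skeleton* of $W$ is a directed graph on the variables, with exponents, in which every variable is either a root (no outgoing arrow) or a pointer with one arrow to a variable at which it points. A skeleton is *irreducible* for $q$ if it has at most one root and, for every pointer $X_i$, no power $X_i^k$ has charge $kq_i=1$. A gc family is *irreducible* if it has a compact member with a connected irreducible skeleton. The connected skeletons with at most one root and at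 most three variables are $S_{1,1}$: $X_1^{m_1}$; $S_{2,1}$: $X_1^{m_1}X_2+X_2^{m_2}$; $S_{2,2}$: $X_1^{m_1}X_2+X_2^{m_2}X_1$; $S_{3,1}$: $X_1^{m_1}X_2+X_2^{m_2}X_3+X_3^{m_3}$; $S_{3,2}$: $X_1^{m_1}X_2+X_2^{m_2}+X_3^{m_3}X_2$; $S_{3,3}$: $X_1^{m_1}X_2+X_2^{m_2}X_3+X_3^{m_3}X_1$; $S_{3,4}$: $X_1^{m_1}X_2+X_2^{m_2}X_1+X_3^{m_3}X_2$. Exponents are integers, at least $3$ for a root and at least $2$ for a pointer; they determine $q$ by requiring each displayed monomial to have charge $1$. They are *feasible* if for any two pointers $X_i\neq X_j$ with the same target there are integers $a,b\ge0$ with $aq_i+bq_j=1$ (a condition only for $S_{3,2}$ and $S_{3,4}$, with $\{i,j\}=\{1,3\}$). Feasible exponents are *irreducible* if the skeleton is irreducible for $q$. Charge vectors are considered up to permutation; $k,l,s,t$ are integers. **Theorem.** (1) Every gc family with $n\le3$ and $c<6$ that is indecomposable or irreducible has its charges in the following lists. * $n=1$: $\left(\frac1k\right)$, $k\ge3$.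 * $n=2$: $\left(\frac{l-1}{kl},\frac1l\right)$ with $k\ge2$, $l\ge3$; or $\left(\frac{l-1}{kl-1},\frac{k-1}{kl-1}\right)$ with $k,l\ge2$. * $n=3$, families from $S_{3,1}$: for $k\ge2$, $\left(\frac{7}{9k},\frac29,\frac13\right)$, $\left(\frac{3k-2}{9k},\frac{2}{3k},\frac13\right)$, $\left(\frac{3k-2}{12k},\frac{2}{3k},\frac13\right)$, $\left(\frac{3k-2}{15k},\frac{2}{3k},\frac13\right)$, $\left(\frac{3k-2}{18k},\frac{2}{3k},\frac13\right)$, $\left(\frac{4k-3}{12k},\frac{3}{4k},\frac14\right)$, $\left(\frac{4k-3}{16k},\frac{3}{4k},\frac14\right)$, $\left(\frac{5k-4}{15k},\frac{4}{5k},\frac15\right)$, $\left(\frac{6k-5}{18k},\frac{5}{6k},\frac16\right)$; for $k\ge3$, $\left(\frac{2k+1}{9k},\frac{k-1}{3k},\frac1k\right)$, $\left(\frac{2k+1}{12k},\frac{k-1}{3k},\frac1k\right)$, $\left(\frac{3k+1}{12k},\frac{k-1}{4k},\frac1k\right)$; for $k\ge2$, $l\ge3$, $\left(\frac{l+1}{2lk},\frac{l-1}{2l},\frac1l\right)$,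 $\left(\frac{kl-l+1}{2lk},\frac{l-1}{lk},\frac1l\right)$. * $n=3$, family from $S_{3,2}$: $\left(\frac{2k+1}{4k+3},\frac1{4k+3},\frac{2}{(4k+3)(2l+1)}\right)$, $k\ge1$, $l\ge0$. * $n=3$, families from $S_{3,3}$: for $k\ge2$, $\left(\frac{2k+1}{9k+1},\frac{3k-2}{9k+1},\frac{7}{9k+1}\right)$, $\left(\frac{2k+1}{12k+1},\frac{4k-3}{12k+1},\frac{10}{12k+1}\right)$, $\left(\frac{3k+1}{12k+1},\frac{3k-2}{12k+1},\frac{9}{12k+1}\right)$; for $k,l\ge2$, $\left(\frac{kl-l+1}{2kl+1},\frac{2l-1}{2kl+1},\frac{k+1}{2kl+1}\right)$. * $n=3$, families from $S_{3,4}$: $\left(\frac{2}{Q},\frac{2l+1}{Q},\frac{2k(2l+1)+1}{Q}\right)$ with $Q=8kl+4k+2l+3$, $k,l\ge1$; $\left(\frac{3}{12k-5},\frac{3k-2}{12k-5},\frac{3k-1}{12k-5}\right)$, $k\ge2$; $\left(\frac{2}{12k+5},\frac{4k+1}{12k+5},\frac{2k+1}{12k+5}\right)$, $k\ge1$. * $n=3$: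 one of the 236 sporadic charge vectors listed at the end. (2) Conversely, the three families for $n\le2$ are exactly the charges of feasible exponents of $S_{1,1}$, $S_{2,1}$, $S_{2,2}$ with $c<6$, respectively; all members of the families from $S_{3,1}$ and $S_{3,3}$ are charges of feasible exponents with $c<6$ of these skeletons, and all members of the families from $S_{3,2}$ and $S_{3,4}$ are charges of irreducible feasible exponents with $c<6$ of these skeletons. (3) The charges of irreducible feasible exponents with $c<6$ on $S_{3,1},\dots,S_{3,4}$ that lie outside the following infinite families of exponents are exactly the 236 distinct sporadic charge vectors (here $*$ is arbitrary): * $S_{3,1}$: $(2,*,*)$, $(*,2,*)$, $(3,3,*)$, $(3,*,3)$, $(*,3,3)$, $(3,4,*)$, $(3,*,4)$, $(*,3,4)$, $(4,3,*)$, $(4,*,3)$, $(*,4,3)$, $(3,*,5)$, $(3,*,6)$, $(4,*,4)$, $(5,*,3)$, $(6,*,3)$. * $S_{3,2}$: $(2,4t+3,(2s+1)(2t+1))$ with $s\ge0$, $t\ge1$, up to exchanging $m_1$ and $m_3$. * $S_{3,3}$: $(2,*,*)$, $(3,3,*)$, $(3,4,*)$, $(4,3,*)$, up to cyclic permutation.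 * $S_{3,4}$: $(2t(2s+1)+1,4t+1,2)$ with $s,t\ge1$; $(4s+2,3,4)$ with $s\ge1$; $(3s-1,4,3)$ with $s\ge2$. (4) For $S_{3,2}$, exponents $(m_1,m_2,m_3)$ with $m_1\le m_3$ are feasible and irreducible with $c<6$ if and only if they are $(2,4t+3,(2s+1)(2t+1))$ for some $s\ge0$, $t\ge1$, or one of the five triples $(3,7,4)$, $(3,7,8)$, $(3,7,10)$, $(3,13,4)$, $(3,16,5)$. **Sporadic charge vectors.** An entry $(a_1,a_2,a_3)$ after "$b$:" stands for $\left(\frac{a_1}{b},\frac{a_2}{b},\frac{a_3}{b}\right)$. $11$: $(1,2,3)$; $13$: $(1,3,4)$; $14$: $(2,3,4)$; $16$: $(1,3,5)$; $17$: $(2,3,5)$; $23$: $(2,3,7)$, $(3,4,5)$; $28$: $(3,4,8)$, $(3,5,7)$; $35$: $(2,5,11)$, $(3,5,10)$; $36$: $(3,5,11)$, $(4,7,8)$; $39$: $(3,6,11)$; $40$: $(5,7,11)$; $42$: $(5,6,12)$; $48$: $(3,9,13)$; $49$: $(5,7,14)$; $50$: $(5,7,15)$; $51$: $(2,7,17)$,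 $(3,7,16)$; $56$: $(5,8,16)$, $(8,11,12)$; $60$: $(6,7,18)$, $(6,9,17)$, $(8,12,13)$; $63$: $(3,12,17)$, $(5,9,18)$, $(6,9,19)$; $64$: $(7,8,19)$; $65$: $(5,9,20)$; $70$: $(5,13,19)$, $(10,11,15)$; $75$: $(10,13,15)$, $(11,15,20)$; $76$: $(11,13,21)$; $80$: $(5,11,25)$, $(13,15,20)$; $81$: $(9,12,23)$, $(13,16,17)$; $84$: $(9,12,25)$; $85$: $(5,16,23)$; $88$: $(7,11,27)$, $(8,17,20)$; $90$: $(11,18,24)$, $(13,15,25)$; $91$: $(11,16,25)$; $95$: $(5,13,30)$; $96$: $(13,18,24)$, $(16,19,20)$; $97$: $(13,19,21)$; $99$: $(9,15,28)$; $100$: $(5,19,27)$, $(8,20,23)$, $(15,17,25)$, $(16,20,21)$; $101$: $(16,17,21)$; $105$: $(9,15,32)$, $(11,21,28)$, $(13,14,35)$, $(15,18,29)$; $106$: $(11,19,29)$, $(13,15,31)$; $108$: $(13,18,30)$; $109$: $(13,16,31)$; $112$: $(13,21,28)$; $113$: $(13,22,25)$; $115$: $(5,22,31)$; $120$: $(11,24,32)$,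 $(13,16,40)$, $(15,17,35)$, $(17,18,30)$, $(19,20,25)$; $121$: $(13,17,36)$, $(16,21,25)$, $(17,19,26)$; $125$: $(20,21,25)$; $126$: $(13,21,35)$; $127$: $(13,19,36)$, $(15,16,37)$; $128$: $(13,24,32)$, $(16,25,28)$; $129$: $(13,25,29)$; $135$: $(9,21,38)$, $(11,27,36)$, $(12,15,41)$, $(13,18,45)$, $(15,19,40)$, $(15,24,37)$; $136$: $(11,25,37)$, $(13,19,41)$; $140$: $(16,28,31)$, $(17,21,35)$, $(20,24,29)$; $144$: $(13,24,40)$, $(13,27,36)$, $(17,18,42)$, $(18,21,41)$, $(19,24,30)$, $(20,24,31)$; $145$: $(13,22,41)$, $(13,28,33)$, $(16,17,43)$; $147$: $(6,21,47)$, $(9,21,46)$, $(14,19,49)$, $(18,21,43)$; $148$: $(15,19,43)$; $150$: $(11,30,40)$, $(13,20,50)$, $(15,27,41)$; $151$: $(11,28,41)$, $(13,21,46)$; $160$: $(13,30,40)$, $(15,29,40)$, $(16,31,36)$, $(17,24,40)$, $(20,28,33)$; $161$: $(13,31,37)$; $162$: $(13,27,45)$, $(18,19,48)$; $163$: $(13,25,46)$,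 $(16,19,49)$; $165$: $(13,22,55)$, $(15,23,50)$; $166$: $(11,31,45)$, $(13,23,51)$; $168$: $(9,24,53)$, $(16,19,56)$, $(17,21,49)$, $(18,25,42)$, $(20,28,37)$; $169$: $(15,22,49)$, $(17,19,50)$; $176$: $(13,33,44)$; $180$: $(11,36,48)$, $(13,24,60)$, $(13,30,50)$, $(15,33,49)$, $(16,36,41)$; $181$: $(11,34,49)$, $(13,25,56)$, $(13,28,51)$, $(16,21,55)$; $189$: $(14,25,63)$, $(18,19,63)$, $(19,21,56)$, $(21,24,55)$; $192$: $(13,36,48)$, $(16,37,44)$, $(17,24,56)$; $195$: $(11,39,52)$, $(15,36,53)$; $196$: $(11,37,53)$, $(13,27,61)$; $198$: $(13,33,55)$, $(18,23,60)$; $199$: $(13,31,56)$, $(16,23,61)$; $200$: $(15,37,50)$; $210$: $(9,30,67)$, $(11,42,56)$, $(13,28,70)$, $(15,29,65)$, $(19,20,70)$, $(21,27,61)$; $211$: $(11,40,57)$, $(13,29,66)$; $216$: $(13,36,60)$, $(16,25,72)$, $(18,25,66)$, $(18,33,61)$, $(21,27,65)$; $220$: $(15,41,55)$, $(16,44,51)$;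 $225$: $(11,45,60)$, $(13,30,75)$, $(15,31,70)$, $(15,42,61)$; $226$: $(11,43,61)$, $(13,31,71)$; $231$: $(9,33,74)$, $(14,31,77)$, $(18,33,71)$, $(19,22,77)$, $(21,30,67)$; $240$: $(11,48,64)$, $(13,32,80)$, $(21,30,73)$, $(24,27,71)$; $241$: $(11,46,65)$, $(13,33,76)$; $243$: $(18,25,81)$, $(24,27,73)$; $252$: $(18,39,71)$, $(19,24,84)$, $(21,33,73)$; $255$: $(11,51,68)$, $(13,34,85)$; $256$: $(11,49,69)$, $(13,35,81)$; $264$: $(16,31,88)$; $270$: $(11,54,72)$, $(13,36,90)$, $(15,37,85)$, $(15,51,73)$; $271$: $(11,52,73)$, $(13,37,86)$; $273$: $(14,37,91)$, $(18,39,85)$; $285$: $(11,57,76)$, $(13,38,95)$, $(15,54,77)$; $288$: $(21,36,89)$; $300$: $(11,60,80)$, $(13,40,100)$, $(15,41,95)$; $312$: $(16,37,104)$, $(21,39,97)$; $315$: $(11,63,84)$, $(13,42,105)$, $(14,43,105)$, $(15,43,100)$; $330$: $(13,44,110)$, $(15,63,89)$; $345$: $(13,46,115)$; $357$: $(18,51,113)$;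 $360$: $(13,48,120)$, $(15,69,97)$; $375$: $(13,50,125)$, $(15,72,101)$; $399$: $(14,55,133)$, $(18,57,127)$; $441$: $(14,61,147)$; $483$: $(14,67,161)$, $(18,69,155)$. -/

import Mathlib

namespace LG

open MvPolynomial

/-! Charge vectors, superpotentials and generically compact families. -/

/-- The family of superpotentials with charge vector `q`: all polynomials each of whose monomials
`∏ X_i ^ p_i` satisfies `∑ p_i q_i = 1`. -/
def Family {n : ℕ} (q : Fin n → ℚ) : Set (MvPolynomial (Fin n) ℂ) :=
  {W | IsWeightedHomogeneous q W 1}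

/-- `W` is compact if the origin is its unique critical point. -/
def Compact {n : ℕ} (W : MvPolynomial (Fin n) ℂ) : Prop :=
  ∀ x : Fin n → ℂ, (∀ i, eval x (pderiv i W) = 0) ↔ x = 0

/-- `q` is the charge vector of a generically compact family: `0 < q i < 1/2`, and the member of
the family with coefficients `a_p` is compact whenever `a` lies outside the zero set of some
nonzero polynomial `F` in the coefficients. -/
def GenericallyCompact {n : ℕ} (q : Fin n → ℚ) : Prop :=
  (∀ i, 0 < q i ∧ q i < 1 / 2) ∧
    ∃ F : MvPolynomial {p : Fin n →₀ ℕ // Finsupp.weight q p = 1} ℂ, F ≠ 0 ∧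
      ∀ W ∈ Family q, eval (fun p => coeff p.1 W) F ≠ 0 → Compact W

/-- The central charge `c = 3 ∑ (1 - 2 q_i)`. -/
def centralCharge {n : ℕ} (q : Fin n → ℚ) : ℚ := 3 * ∑ i, (1 - 2 * q i)

/-- The charges without their order. -/
def chargesOf {n : ℕ} (q : Fin n → ℚ) : Multiset ℚ := Finset.univ.val.map q

/-- The family of `q` is decomposable if some compact member is a sum of two polynomials
in complementary nonempty sets of variables. -/
def Decomposable {n : ℕ} (q : Fin n → ℚ) : Prop :=
  ∃ W ∈ Family q, Compact W ∧
    ∃ A : Set (Fin n), A.Nonempty ∧ Aᶜ.Nonempty ∧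
      ∃ W₁ ∈ supported ℂ A, ∃ W₂ ∈ supported ℂ Aᶜ, W = W₁ + W₂

/-! Skeleton graphs, exponents and feasibility. -/

/-- A skeleton graph: `t i = none` if node `i` is a root, `t i = some j` if node `i` is a pointer
with an arrow to node `j`. -/
abbrev Skeleton (n : ℕ) := Fin n → Option (Fin n)

/-- `t`, with exponents `m`, is a skeleton graph of `W`: `X_i` is a root if `W` contains
`X_i ^ m_i`, and a pointer at `X_j` if it is not a root and `W` contains `X_i ^ m_i * X_j`. -/
def IsSkeletonOf {n : ℕ} (t : Skeleton n) (m : Fin n → ℕ) (W : MvPolynomial (Fin n) ℂ) : Prop :=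
  (∀ i, t i = none → coeff (Finsupp.single i (m i)) W ≠ 0) ∧
    ∀ i j, t i = some j → j ≠ i ∧ (∀ k : ℕ, coeff (Finsupp.single i k) W = 0) ∧
      coeff (Finsupp.single i (m i) + Finsupp.single j 1) W ≠ 0

/-- The underlying undirected graph of the skeleton is connected. (For `n ≤ 3` a required link
joins nodes with a common target and cannot point at a further node, so links do not affect
connectedness.) -/
def Skeleton.Connected {n : ℕ} (t : Skeleton n) : Prop :=
  (SimpleGraph.fromRel fun i j => t i = some j).Connected

/-- The graph is irreducible: it has at most one root, and no pointer `X_i` can appear as a root,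
that is, no monomial `X_i ^ k` has charge one. -/
def Skeleton.Irreducible {n : ℕ} (t : Skeleton n) (q : Fin n → ℚ) : Prop :=
  (∀ i j, t i = none → t j = none → i = j) ∧
    ∀ i, t i ≠ none → ∀ k : ℕ, (k : ℚ) * q i ≠ 1

/-- The family of `q` has a compact member with a connected irreducible graph. -/
def IrreducibleFamily {n : ℕ} (q : Fin n → ℚ) : Prop :=
  ∃ W ∈ Family q, Compact W ∧ ∃ (t : Skeleton n) (m : Fin n → ℕ),
    IsSkeletonOf t m W ∧ t.Connected ∧ t.Irreducible q

/-- The exponents `m` are admissible for the skeleton (at least `3` at a root, at least `2` at a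
pointer), `q` is the charge vector they determine, and every required link is feasible: for any two
pointers with a common target, some monomial in these two variables has charge one.
(For `n ≤ 3` there are no pointing links.) -/
structure IsFeasible {n : ℕ} (t : Skeleton n) (m : Fin n → ℕ) (q : Fin n → ℚ) : Prop where
  root_exponent : ∀ i, t i = none → 3 ≤ m i
  root_charge : ∀ i, t i = none → (m i : ℚ) * q i = 1
  pointer_exponent : ∀ i j, t i = some j → 2 ≤ m i
  pointer_charge : ∀ i j, t i = some j → (m i : ℚ) * q i + q j = 1
  link : ∀ i j v, i ≠ j → t i = some v → t j = some v →
    ∃ a b : ℕ, (a : ℚ) * q i + (b : ℚ) * q j = 1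

/-- The exponents `m` on the skeleton `t` determine the charge vector `q` and give a feasible
irreducible graph with `c < 6`. -/
def IsIrreducibleExponent {n : ℕ} (t : Skeleton n) (m : Fin n → ℕ) (q : Fin n → ℚ) : Prop :=
  IsFeasible t m q ∧ t.Irreducible q ∧ centralCharge q < 6

/-! The connected skeletons with at most one root in at most three variables
(nodes are numbered from `0`). -/

def S11 : Skeleton 1 := ![none]
def S21 : Skeleton 2 := ![some 1, none]
def S22 : Skeleton 2 := ![some 1, some 0]
def S31 : Skeleton 3 := ![some 1, some 2, none]
def S32 : Skeleton 3 := ![some 1, none, some 1]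
def S33 : Skeleton 3 := ![some 1, some 2, some 0]
def S34 : Skeleton 3 := ![some 1, some 0, some 1]

/-- The charges (without order) of the feasible exponents of `t` with `c < 6`. -/
def feasibleCharges {n : ℕ} (t : Skeleton n) : Set (Multiset ℚ) :=
  {Q | ∃ m q, IsFeasible t m q ∧ centralCharge q < 6 ∧ Q = chargesOf q}

/-- The charges (without order) of the irreducible feasible exponents of `t` with `c < 6` that lie
outside the set `E`. -/
def irreducibleChargesOutside {n : ℕ} (t : Skeleton n) (E : Set (Fin n → ℕ)) :
    Set (Multiset ℚ) :=
  {Q | ∃ m q, IsIrreducibleExponent t m q ∧ m ∉ E ∧ Q = chargesOf q}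

/-! The infinite families of exponents for the skeletons in three variables. -/

def infiniteExponents31 : Set (Fin 3 → ℕ) :=
  {m | m 0 = 2 ∨ m 1 = 2 ∨
    (m 0 = 3 ∧ m 1 = 3) ∨ (m 0 = 3 ∧ m 2 = 3) ∨ (m 1 = 3 ∧ m 2 = 3) ∨
    (m 0 = 3 ∧ m 1 = 4) ∨ (m 0 = 3 ∧ m 2 = 4) ∨ (m 1 = 3 ∧ m 2 = 4) ∨
    (m 0 = 4 ∧ m 1 = 3) ∨ (m 0 = 4 ∧ m 2 = 3) ∨ (m 1 = 4 ∧ m 2 = 3) ∨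
    (m 0 = 3 ∧ m 2 = 5) ∨ (m 0 = 3 ∧ m 2 = 6) ∨ (m 0 = 4 ∧ m 2 = 4) ∨
    (m 0 = 5 ∧ m 2 = 3) ∨ (m 0 = 6 ∧ m 2 = 3)}

/-- Up to the symmetry exchanging the two pointers. -/
def infiniteExponents32 : Set (Fin 3 → ℕ) :=
  {m | ∃ s t : ℕ, 1 ≤ t ∧ (m = ![2, 4 * t + 3, (2 * s + 1) * (2 * t + 1)] ∨
    m = ![(2 * s + 1) * (2 * t + 1), 4 * t + 3, 2])}

/-- Up to cyclic symmetry. -/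
def infiniteExponents33 : Set (Fin 3 → ℕ) :=
  {m | ∃ i : Fin 3, m i = 2 ∨ (m i = 3 ∧ m (i + 1) = 3) ∨ (m i = 3 ∧ m (i + 1) = 4) ∨
    (m i = 4 ∧ m (i + 1) = 3)}

def infiniteExponents34 : Set (Fin 3 → ℕ) :=
  {m | (∃ s t : ℕ, 1 ≤ s ∧ 1 ≤ t ∧ m = ![2 * t * (2 * s + 1) + 1, 4 * t + 1, 2]) ∨
    (∃ s : ℕ, 1 ≤ s ∧ m = ![4 * s + 2, 3, 4]) ∨
    (∃ s : ℕ, 2 ≤ s ∧ m = ![3 * s - 1, 4, 3])}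

/-! The infinite families of charges. -/

def charges11 : Set (Multiset ℚ) := {Q | ∃ k : ℕ, 3 ≤ k ∧ Q = {1 / (k : ℚ)}}

def charges21 : Set (Multiset ℚ) :=
  {Q | ∃ k l : ℕ, 2 ≤ k ∧ 3 ≤ l ∧ Q = {((l : ℚ) - 1) / (k * l), 1 / (l : ℚ)}}

def charges22 : Set (Multiset ℚ) :=
  {Q | ∃ k l : ℕ, 2 ≤ k ∧ 2 ≤ l ∧
    Q = {((l : ℚ) - 1) / (k * l - 1), ((k : ℚ) - 1) / (k * l - 1)}}

/-- The families from `S31`. -/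
def charges31 : Set (Multiset ℚ) :=
  {Q | (∃ k : ℕ, 2 ≤ k ∧
      (Q = {7 / (9 * (k : ℚ)), 2 / 9, 1 / 3} ∨
      Q = {(3 * (k : ℚ) - 2) / (9 * k), 2 / (3 * (k : ℚ)), 1 / 3} ∨
      Q = {(3 * (k : ℚ) - 2) / (12 * k), 2 / (3 * (k : ℚ)), 1 / 3} ∨
      Q = {(3 * (k : ℚ) - 2) / (15 * k), 2 / (3 * (k : ℚ)), 1 / 3} ∨
      Q = {(3 * (k : ℚ) - 2) / (18 * k), 2 / (3 * (k : ℚ)), 1 / 3} ∨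
      Q = {(4 * (k : ℚ) - 3) / (12 * k), 3 / (4 * (k : ℚ)), 1 / 4} ∨
      Q = {(4 * (k : ℚ) - 3) / (16 * k), 3 / (4 * (k : ℚ)), 1 / 4} ∨
      Q = {(5 * (k : ℚ) - 4) / (15 * k), 4 / (5 * (k : ℚ)), 1 / 5} ∨
      Q = {(6 * (k : ℚ) - 5) / (18 * k), 5 / (6 * (k : ℚ)), 1 / 6})) ∨
    (∃ k : ℕ, 3 ≤ k ∧
      (Q = {(2 * (k : ℚ) + 1) / (9 * k), ((k : ℚ) - 1) / (3 * k), 1 / (k : ℚ)} ∨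
      Q = {(2 * (k : ℚ) + 1) / (12 * k), ((k : ℚ) - 1) / (3 * k), 1 / (k : ℚ)} ∨
      Q = {(3 * (k : ℚ) + 1) / (12 * k), ((k : ℚ) - 1) / (4 * k), 1 / (k : ℚ)})) ∨
    (∃ k l : ℕ, 2 ≤ k ∧ 3 ≤ l ∧
      (Q = {((l : ℚ) + 1) / (2 * l * k), ((l : ℚ) - 1) / (2 * l), 1 / (l : ℚ)} ∨
      Q = {((k : ℚ) * l - l + 1) / (2 * l * k), ((l : ℚ) - 1) / (l * k), 1 / (l : ℚ)}))}

/-- The family from `S32`. -/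
def charges32 : Set (Multiset ℚ) :=
  {Q | ∃ k l : ℕ, 1 ≤ k ∧
    Q = {(2 * (k : ℚ) + 1) / (4 * k + 3), 1 / (4 * (k : ℚ) + 3),
      2 / ((4 * (k : ℚ) + 3) * (2 * l + 1))}}

/-- The families from `S33`. -/
def charges33 : Set (Multiset ℚ) :=
  {Q | (∃ k : ℕ, 2 ≤ k ∧
      (Q = {(2 * (k : ℚ) + 1) / (9 * k + 1), (3 * (k : ℚ) - 2) / (9 * k + 1),
        7 / (9 * (k : ℚ) + 1)} ∨
      Q = {(2 * (k : ℚ) + 1) / (12 * k + 1), (4 * (k : ℚ) - 3) / (12 * k + 1),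
        10 / (12 * (k : ℚ) + 1)} ∨
      Q = {(3 * (k : ℚ) + 1) / (12 * k + 1), (3 * (k : ℚ) - 2) / (12 * k + 1),
        9 / (12 * (k : ℚ) + 1)})) ∨
    (∃ k l : ℕ, 2 ≤ k ∧ 2 ≤ l ∧
      Q = {((k : ℚ) * l - l + 1) / (2 * k * l + 1), (2 * (l : ℚ) - 1) / (2 * k * l + 1),
        ((k : ℚ) + 1) / (2 * k * l + 1)})}

/-- The families from `S34`. -/
def charges34 : Set (Multiset ℚ) :=
  {Q | (∃ k l : ℕ, 1 ≤ k ∧ 1 ≤ l ∧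
      Q = {2 / (8 * (k : ℚ) * l + 4 * k + 2 * l + 3),
        (2 * (l : ℚ) + 1) / (8 * k * l + 4 * k + 2 * l + 3),
        (2 * (k : ℚ) * (2 * l + 1) + 1) / (8 * k * l + 4 * k + 2 * l + 3)}) ∨
    (∃ k : ℕ, 2 ≤ k ∧
      Q = {3 / (12 * (k : ℚ) - 5), (3 * (k : ℚ) - 2) / (12 * k - 5),
        (3 * (k : ℚ) - 1) / (12 * k - 5)}) ∨
    (∃ k : ℕ, 1 ≤ k ∧
      Q = {2 / (12 * (k : ℚ) + 5), (4 * (k : ℚ) + 1) / (12 * k + 5),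
        (2 * (k : ℚ) + 1) / (12 * k + 5)})}

/-! The sporadic charges in three variables. -/

/-- An entry `(a₁, a₂, a₃, b)` stands for the charges `a₁ / b`, `a₂ / b`, `a₃ / b`. -/
def sporadicData : List (ℕ × ℕ × ℕ × ℕ) :=
  [
  (1, 2, 3, 11), (1, 3, 4, 13), (2, 3, 4, 14), (1, 3, 5, 16), (2, 3, 5, 17),
  (2, 3, 7, 23), (3, 4, 5, 23), (3, 4, 8, 28), (3, 5, 7, 28), (2, 5, 11, 35),
  (3, 5, 10, 35), (3, 5, 11, 36), (4, 7, 8, 36), (3, 6, 11, 39), (5, 7, 11, 40),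
  (5, 6, 12, 42), (3, 9, 13, 48), (5, 7, 14, 49), (5, 7, 15, 50), (2, 7, 17, 51),
  (3, 7, 16, 51), (5, 8, 16, 56), (8, 11, 12, 56), (6, 7, 18, 60), (6, 9, 17, 60),
  (8, 12, 13, 60), (3, 12, 17, 63), (5, 9, 18, 63), (6, 9, 19, 63), (7, 8, 19, 64),
  (5, 9, 20, 65), (5, 13, 19, 70), (10, 11, 15, 70), (10, 13, 15, 75), (11, 15, 20, 75),
  (11, 13, 21, 76), (5, 11, 25, 80), (13, 15, 20, 80), (9, 12, 23, 81), (13, 16, 17, 81),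
  (9, 12, 25, 84), (5, 16, 23, 85), (7, 11, 27, 88), (8, 17, 20, 88), (11, 18, 24, 90),
  (13, 15, 25, 90), (11, 16, 25, 91), (5, 13, 30, 95), (13, 18, 24, 96), (16, 19, 20, 96),
  (13, 19, 21, 97), (9, 15, 28, 99), (5, 19, 27, 100), (8, 20, 23, 100), (15, 17, 25, 100),
  (16, 20, 21, 100), (16, 17, 21, 101), (9, 15, 32, 105), (11, 21, 28, 105), (13, 14, 35, 105),
  (15, 18, 29, 105), (11, 19, 29, 106), (13, 15, 31, 106), (13, 18, 30, 108), (13, 16, 31, 109),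
  (13, 21, 28, 112), (13, 22, 25, 113), (5, 22, 31, 115), (11, 24, 32, 120), (13, 16, 40, 120),
  (15, 17, 35, 120), (17, 18, 30, 120), (19, 20, 25, 120), (13, 17, 36, 121), (16, 21, 25, 121),
  (17, 19, 26, 121), (20, 21, 25, 125), (13, 21, 35, 126), (13, 19, 36, 127), (15, 16, 37, 127),
  (13, 24, 32, 128), (16, 25, 28, 128), (13, 25, 29, 129), (9, 21, 38, 135), (11, 27, 36, 135),
  (12, 15, 41, 135), (13, 18, 45, 135), (15, 19, 40, 135), (15, 24, 37, 135), (11, 25, 37, 136),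
  (13, 19, 41, 136), (16, 28, 31, 140), (17, 21, 35, 140), (20, 24, 29, 140), (13, 24, 40, 144),
  (13, 27, 36, 144), (17, 18, 42, 144), (18, 21, 41, 144), (19, 24, 30, 144), (20, 24, 31, 144),
  (13, 22, 41, 145), (13, 28, 33, 145), (16, 17, 43, 145), (6, 21, 47, 147), (9, 21, 46, 147),
  (14, 19, 49, 147), (18, 21, 43, 147), (15, 19, 43, 148), (11, 30, 40, 150), (13, 20, 50, 150),
  (15, 27, 41, 150), (11, 28, 41, 151), (13, 21, 46, 151), (13, 30, 40, 160), (15, 29, 40, 160),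
  (16, 31, 36, 160), (17, 24, 40, 160), (20, 28, 33, 160), (13, 31, 37, 161), (13, 27, 45, 162),
  (18, 19, 48, 162), (13, 25, 46, 163), (16, 19, 49, 163), (13, 22, 55, 165), (15, 23, 50, 165),
  (11, 31, 45, 166), (13, 23, 51, 166), (9, 24, 53, 168), (16, 19, 56, 168), (17, 21, 49, 168),
  (18, 25, 42, 168), (20, 28, 37, 168), (15, 22, 49, 169), (17, 19, 50, 169), (13, 33, 44, 176),
  (11, 36, 48, 180), (13, 24, 60, 180), (13, 30, 50, 180), (15, 33, 49, 180), (16, 36, 41, 180),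
  (11, 34, 49, 181), (13, 25, 56, 181), (13, 28, 51, 181), (16, 21, 55, 181), (14, 25, 63, 189),
  (18, 19, 63, 189), (19, 21, 56, 189), (21, 24, 55, 189), (13, 36, 48, 192), (16, 37, 44, 192),
  (17, 24, 56, 192), (11, 39, 52, 195), (15, 36, 53, 195), (11, 37, 53, 196), (13, 27, 61, 196),
  (13, 33, 55, 198), (18, 23, 60, 198), (13, 31, 56, 199), (16, 23, 61, 199), (15, 37, 50, 200),
  (9, 30, 67, 210), (11, 42, 56, 210), (13, 28, 70, 210), (15, 29, 65, 210), (19, 20, 70, 210),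
  (21, 27, 61, 210), (11, 40, 57, 211), (13, 29, 66, 211), (13, 36, 60, 216), (16, 25, 72, 216),
  (18, 25, 66, 216), (18, 33, 61, 216), (21, 27, 65, 216), (15, 41, 55, 220), (16, 44, 51, 220),
  (11, 45, 60, 225), (13, 30, 75, 225), (15, 31, 70, 225), (15, 42, 61, 225), (11, 43, 61, 226),
  (13, 31, 71, 226), (9, 33, 74, 231), (14, 31, 77, 231), (18, 33, 71, 231), (19, 22, 77, 231),
  (21, 30, 67, 231), (11, 48, 64, 240), (13, 32, 80, 240), (21, 30, 73, 240), (24, 27, 71, 240),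
  (11, 46, 65, 241), (13, 33, 76, 241), (18, 25, 81, 243), (24, 27, 73, 243), (18, 39, 71, 252),
  (19, 24, 84, 252), (21, 33, 73, 252), (11, 51, 68, 255), (13, 34, 85, 255), (11, 49, 69, 256),
  (13, 35, 81, 256), (16, 31, 88, 264), (11, 54, 72, 270), (13, 36, 90, 270), (15, 37, 85, 270),
  (15, 51, 73, 270), (11, 52, 73, 271), (13, 37, 86, 271), (14, 37, 91, 273), (18, 39, 85, 273),
  (11, 57, 76, 285), (13, 38, 95, 285), (15, 54, 77, 285), (21, 36, 89, 288), (11, 60, 80, 300),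
  (13, 40, 100, 300), (15, 41, 95, 300), (16, 37, 104, 312), (21, 39, 97, 312), (11, 63, 84, 315),
  (13, 42, 105, 315), (14, 43, 105, 315), (15, 43, 100, 315), (13, 44, 110, 330), (15, 63, 89, 330),
  (13, 46, 115, 345), (18, 51, 113, 357), (13, 48, 120, 360), (15, 69, 97, 360), (13, 50, 125, 375),
  (15, 72, 101, 375), (14, 55, 133, 399), (18, 57, 127, 399), (14, 61, 147, 441), (14, 67, 161, 483),
  (18, 69, 155, 483)]

def sporadicCharges : Set (Multiset ℚ) :=
  {Q | ∃ a₁ a₂ a₃ b : ℕ, (a₁, a₂, a₃, b) ∈ sporadicData ∧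
    Q = {(a₁ : ℚ) / b, (a₂ : ℚ) / b, (a₃ : ℚ) / b}}

end LG

namespace LG

open MvPolynomial

/-! Compactness forces monomials. If a partial derivative of `W` is nonzero at `x`, some monomial of
`W` survives there. At coordinate vectors this gives every variable a root or pointer exponent
(`exists_axis_charge`); in three variables, at a suitable point of a coordinate plane, it gives the
monomial required by a link (`exists_link_charge`). So the charges come from feasible exponents on a
skeleton. Skeletons in which a root stands apart from the rest are impossible: if the family is
indecomposable, an explicit Fermat, chain or loop polynomial contradicts this
(`decomposable_of_root_add` for three variables), and the irreducible alternative forbids a second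
root and a disconnected graph. Only the listed connected skeletons remain.

In three variables the equations for the charges are solved as `x / d`, `y / d`, `z / d`. Then `c <
6` reads `d < 2 * (x + y + z)`, irreducibility says that pointer numerators do not divide `d`, and a
link is an equation in natural numbers.

On `S31` and `S33` the inequality is linear in each exponent separately. Its coefficient is `(u - 2)
* (v - 2) - 2` in the other two exponents `u`, `v`, with `4` in place of the last `2` for the middle
exponent of `S31`. Where the coefficient is not positive, the inequality leaves the third exponent
free; these pairs are the infinite families. Where all three coefficients are positive, all
exponents are bounded (`bounds_S31`, `bound_S33`).

On `S32` and `S34` arithmetic does most of the work: the link makes one number divide a product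
(`dvd_mul`), while irreducibility keeps it from dividing one or both factors. Congruences then
produce the infinite families, and the charge inequality bounds the rest
(`IrreducibleNumerics32.of_three_le`, `IrreducibleNumerics34.bounds`).

What remains is finite: the boxes are searched by computation. Conversely, an entry of the sporadic
list, in the right order, determines its exponents by division. -/

theorem weight_eq_sum {n : ℕ} (q : Fin n → ℚ) (d : Fin n →₀ ℕ) :
    Finsupp.weight q d = ∑ i, (d i : ℚ) * q i := by
  rw [Finsupp.weight_apply, Finsupp.sum_fintype _ _ (by simp)]
  simp

/-! ### Compact members and the monomials they must contain -/

/-- A nonzero polynomial over the infinite field `ℂ` has a point `x` where it does not vanish. Only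
the finitely many coefficients in `F.vars` matter for its value, so the member of the family with
just these coefficients is a polynomial and is compact. -/
theorem GenericallyCompact.exists_compact {n : ℕ} {q : Fin n → ℚ} (h : GenericallyCompact q) :
    ∃ W ∈ Family q, Compact W := by
  obtain ⟨-, F, hF, hW⟩ := h
  obtain ⟨x, hx⟩ : ∃ x, eval x F ≠ 0 := by
    by_contra! hall
    exact hF (MvPolynomial.funext fun x => by simpa using hall x)
  refine ⟨∑ p ∈ F.vars, monomial p.1 (x p), ?_, ?_⟩
  · exact IsWeightedHomogeneous.sum _ _ _ fun p _ => isWeightedHomogeneous_monomial _ _ _ p.2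
  · refine hW _ (IsWeightedHomogeneous.sum _ _ _
      fun p _ => isWeightedHomogeneous_monomial _ _ _ p.2) ?_
    convert hx using 1
    refine eval₂Hom_congr' rfl (fun p hp _ => ?_) rfl
    rw [coeff_sum, Finset.sum_eq_single p]
    · simp
    · intro b _ hb
      rw [coeff_monomial, if_neg (fun h => hb (Subtype.ext h))]
    · exact fun h => absurd hp h

theorem pderiv_eq_sum {n : ℕ} (W : MvPolynomial (Fin n) ℂ) (j : Fin n) :
    pderiv j W = ∑ d ∈ W.support, monomial (d - Finsupp.single j 1) (coeff d W * d j) := by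
  conv_lhs => rw [← support_sum_monomial_coeff W]
  rw [map_sum]
  exact Finset.sum_congr rfl fun d _ => pderiv_monomial

/-- Some term of the derivative must be nonzero at `x`, and a monomial is nonzero exactly where all
its variables are. Choosing `x` with many zeros therefore pins down the monomial of `W` behind that
term. -/
theorem exists_coeff_ne_zero_of_eval_pderiv_ne_zero {n : ℕ} {W : MvPolynomial (Fin n) ℂ}
    {x : Fin n → ℂ} {j : Fin n} (h : eval x (pderiv j W) ≠ 0) :
    ∃ d, coeff d W ≠ 0 ∧ d j ≠ 0 ∧ ∀ k, (d - Finsupp.single j 1 : Fin n →₀ ℕ) k ≠ 0 → x k ≠ 0 := by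
  rw [pderiv_eq_sum, map_sum] at h
  obtain ⟨d, hd, hne⟩ := Finset.exists_ne_zero_of_sum_ne_zero h
  rw [eval_monomial, Finsupp.prod_fintype _ _ (by simp)] at hne
  refine ⟨d, by simpa using hd, ?_, ?_⟩
  · rintro h0
    simp [h0] at hne
  · intro k hk hx
    apply hne
    rw [Finset.prod_eq_zero (Finset.mem_univ k), mul_zero]
    rw [hx, zero_pow hk]

theorem exists_eval_pderiv_ne_zero {n : ℕ} {W : MvPolynomial (Fin n) ℂ} (hc : Compact W)
    {x : Fin n → ℂ} (hx : x ≠ 0) : ∃ j, eval x (pderiv j W) ≠ 0 := by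
  by_contra! h
  exact hx ((hc x).1 h)

/-- A compact polynomial contains a monomial `X_i ^ m` or `X_i ^ m * X_j` for every `i`. -/
theorem exists_axis_charge {n : ℕ} {q : Fin n → ℚ} {W : MvPolynomial (Fin n) ℂ}
    (hW : W ∈ Family q) (hc : Compact W) (i : Fin n) :
    (∃ m : ℕ, (m : ℚ) * q i = 1) ∨ ∃ j, j ≠ i ∧ ∃ m : ℕ, (m : ℚ) * q i + q j = 1 := by
  -- At the `i`-th coordinate vector a surviving term of `∂_j W` is a pure power of `X_i`, so `W`
  -- contains a power of `X_i` times `X_j`.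
  obtain ⟨j, hj⟩ := exists_eval_pderiv_ne_zero hc (x := Pi.single i 1) (by simp)
  obtain ⟨d, hd, hdj, hk⟩ := exists_coeff_ne_zero_of_eval_pderiv_ne_zero hj
  have hk' : ∀ k, k ≠ i → (d - Finsupp.single j 1 : Fin n →₀ ℕ) k = 0 := by
    intro k hki
    by_contra h
    exact hk k h (by simp [hki])
  have hw : Finsupp.weight q d = 1 := hW hd
  have hd' : d = (d - Finsupp.single j 1) + Finsupp.single j 1 := by
    rw [tsub_add_cancel_of_le]
    simpa using Nat.one_le_iff_ne_zero.2 hdj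
  have hs : d - Finsupp.single j 1 = Finsupp.single i ((d - Finsupp.single j 1 : Fin n →₀ ℕ) i) := by
    ext k
    by_cases hki : k = i
    · simp [hki]
    · rw [hk' k hki, Finsupp.single_eq_of_ne hki]
  rw [hd', map_add, hs, Finsupp.weight_single, Finsupp.weight_single, one_smul, nsmul_eq_mul] at hw
  by_cases hji : j = i
  · subst hji
    exact Or.inl ⟨_ + 1, by push_cast; rw [add_mul, one_mul]; exact hw⟩
  · exact Or.inr ⟨j, hji, _, hw⟩

/-! ### Links in three variables -/

theorem univ_eq_of_distinct {i j v : Fin 3} (hij : i ≠ j) (hiv : i ≠ v) (hjv : j ≠ v) :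
    (Finset.univ : Finset (Fin 3)) = {i, j, v} := by
  revert i j v
  decide

theorem sum_eq_of_distinct {M : Type*} [AddCommMonoid M] {i j v : Fin 3} (hij : i ≠ j)
    (hiv : i ≠ v) (hjv : j ≠ v) (f : Fin 3 → M) : ∑ k, f k = f i + (f j + f v) := by
  rw [univ_eq_of_distinct hij hiv hjv, Finset.sum_insert (by simp [hij, hiv]),
    Finset.sum_insert (by simp [hjv]), Finset.sum_singleton]

theorem prod_eq_of_distinct {M : Type*} [CommMonoid M] {i j v : Fin 3} (hij : i ≠ j)
    (hiv : i ≠ v) (hjv : j ≠ v) (f : Fin 3 → M) : ∏ k, f k = f i * (f j * f v) := by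
  rw [univ_eq_of_distinct hij hiv hjv, Finset.prod_insert (by simp [hij, hiv]),
    Finset.prod_insert (by simp [hjv]), Finset.prod_singleton]

theorem eq_of_distinct {i j v : Fin 3} (hij : i ≠ j) (hiv : i ≠ v) (hjv : j ≠ v) (k : Fin 3) :
    k = i ∨ k = j ∨ k = v := by
  revert i j v k
  decide

/-- On the plane `x_v = 0` the polynomial `∂_v W` is weighted homogeneous in two variables. If it
does not vanish at the `j`-th coordinate vector, it contains a pure power of `X_j`, so setting `x_i
= 1` leaves a nonconstant polynomial in one variable, which has a complex root. -/
theorem exists_link_zero {q : Fin 3 → ℚ} {W : MvPolynomial (Fin 3) ℂ} (hW : W ∈ Family q)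
    {i j v : Fin 3} (hq : 0 < q i) (hqv : q v < 1) (hij : i ≠ j) (hiv : i ≠ v) (hjv : j ≠ v) :
    ∃ x : Fin 3 → ℂ, x ≠ 0 ∧ x v = 0 ∧ eval x (pderiv v W) = 0 := by
  by_contra! hall
  have h1 : eval (Pi.single j 1) (pderiv v W) ≠ 0 := hall _ (by simp) (by simp [hjv.symm])
  obtain ⟨d, hd, hdv, hk⟩ := exists_coeff_ne_zero_of_eval_pderiv_ne_zero h1
  have hdi : d i = 0 := by
    by_contra h
    exact hk i (by simp [h, hiv]) (by simp [hij])
  have hdv1 : d v - 1 = 0 := by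
    by_contra h
    exact hk v (by simpa using h) (by simp [hjv.symm])
  have hw : ∀ d, coeff d W ≠ 0 → (d i : ℚ) * q i + (d j * q j + d v * q v) = 1 := by
    intro d hd
    rw [← sum_eq_of_distinct hij hiv hjv fun k => (d k : ℚ) * q k, ← weight_eq_sum]
    exact hW hd
  have hdw := hw d hd
  have hdv' : d v = 1 := by omega
  rw [hdi, hdv'] at hdw
  -- The monomial is `X_j ^ (d j) * X_v`; the bound `q v < 1` excludes `X_v` alone.
  have hdj : d j ≠ 0 := by
    intro h
    rw [h] at hdw
    simp at hdw
    linarith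
  -- `p` is `∂_v W` restricted to the line `x_i = 1`, `x_v = 0`, with `x_j` as its variable.
  let y : Fin 3 → Polynomial ℂ := fun k => if k = i then 1 else if k = j then Polynomial.X else 0
  let p : Polynomial ℂ := eval₂ Polynomial.C y (pderiv v W)
  have hp : p.coeff (d j) = coeff d W := by
    have : p = ∑ e ∈ W.support, Polynomial.C (coeff e W * e v) *
        (Polynomial.X ^ e j * 0 ^ (e v - 1)) := by
      simp only [p]
      rw [pderiv_eq_sum, eval₂_sum]
      refine Finset.sum_congr rfl fun e _ => ?_
      rw [eval₂_monomial, Finsupp.prod_fintype _ _ (by simp), prod_eq_of_distinct hij hiv hjv]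
      simp [y, hij.symm, hiv, hiv.symm, hjv, hjv.symm]
    rw [this, Polynomial.finsetSum_coeff, Finset.sum_eq_single d]
    · simp [hdv']
    · intro e he hne
      by_cases hev : e v = 0
      · simp [hev]
      by_cases hev1 : e v - 1 = 0
      -- A monomial that is linear in `X_v` and has the same exponent of `X_j` as `d` also has the
      -- same exponent of `X_i`, because its charge is fixed and `q i ≠ 0`. So nothing cancels
      -- `coeff d W`.
      · rw [hev1, pow_zero, mul_one, Polynomial.coeff_C_mul_X_pow, if_neg]
        intro hej
        apply hne
        have hew := hw e (by simpa using he)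
        have hev' : e v = 1 := by omega
        rw [hev', ← hej] at hew
        have : (e i : ℚ) * q i = 0 := by push_cast at hdw hew; linarith
        have : e i = 0 := by
          rcases mul_eq_zero.1 this with h | h
          · exact_mod_cast h
          · exact absurd h hq.ne'
        ext k
        rcases eq_of_distinct hij hiv hjv k with rfl | rfl | rfl
        · rw [this, hdi]
        · exact hej.symm
        · rw [hev', hdv']
      · simp [hev1]
    · intro h
      exact absurd (by simpa using hd) h
  have hdeg : p.degree ≠ 0 := by
    intro h
    have := Polynomial.coeff_eq_zero_of_degree_lt (p := p) (n := d j)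
      (by rw [h]; exact_mod_cast Nat.pos_of_ne_zero hdj)
    exact hd (hp ▸ this)
  obtain ⟨u, hu⟩ := IsAlgClosed.exists_root p hdeg
  refine hall (fun k => if k = i then 1 else if k = j then u else 0) ?_ ?_ ?_
  · intro h
    simpa using congrFun h i
  · simp [hiv.symm, hjv.symm]
  · rw [Polynomial.IsRoot.def] at hu
    refine Eq.trans ?_ hu
    simp only [p]
    rw [← Polynomial.coe_evalRingHom, eval₂_comp_left]
    rw [← eval₂_id]
    congr 1
    · ext1 z
      simp
    · ext1 k
      simp only [y, Function.comp_apply]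
      split_ifs <;> simp

/-- Two pointers with a common target require a link. -/
theorem exists_link_charge {q : Fin 3 → ℚ} {W : MvPolynomial (Fin 3) ℂ} (hW : W ∈ Family q)
    (hc : Compact W) {i j v : Fin 3} (hq : 0 < q i) (hqv : q v < 1) (hij : i ≠ j) (hiv : i ≠ v)
    (hjv : j ≠ v) : ∃ a b : ℕ, (a : ℚ) * q i + (b : ℚ) * q j = 1 := by
  -- At this point `∂_v W` vanishes, so some other derivative `∂_k W` does not. Differentiating
  -- along `k ≠ v` leaves the exponent of `X_v` untouched, and `x v = 0` forces it to be zero: the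
  -- monomial found involves only `X_i` and `X_j`.
  obtain ⟨x, hx, hxv, hx0⟩ := exists_link_zero hW hq hqv hij hiv hjv
  obtain ⟨k, hk⟩ := exists_eval_pderiv_ne_zero hc hx
  have hkv : v ≠ k := fun h => hk (h ▸ hx0)
  obtain ⟨d, hd, -, hdk⟩ := exists_coeff_ne_zero_of_eval_pderiv_ne_zero hk
  have hdv : d v = 0 := by
    by_contra h
    exact hdk v (by simp [hkv, h]) hxv
  have hw : Finsupp.weight q d = 1 := hW hd
  rw [weight_eq_sum, sum_eq_of_distinct hij hiv hjv, hdv] at hw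
  exact ⟨d i, d j, by simpa using hw⟩

/-- A compact member of a family gives every variable a root or a pointer exponent; roots are
chosen whenever the charges allow them. -/
theorem exists_skeleton {n : ℕ} {q : Fin n → ℚ}
    {W : MvPolynomial (Fin n) ℂ} (hW : W ∈ Family q) (hc : Compact W) :
    ∃ (t : Skeleton n) (m : Fin n → ℕ), (∀ i, t i ≠ some i) ∧
      (∀ i, t i = none → (m i : ℚ) * q i = 1) ∧
      (∀ i j, t i = some j → (m i : ℚ) * q i + q j = 1) ∧
      ∀ i, t i ≠ none → ∀ k : ℕ, (k : ℚ) * q i ≠ 1 := by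
  have h : ∀ i, ∃ (o : Option (Fin n)) (k : ℕ), o ≠ some i ∧ (o = none → (k : ℚ) * q i = 1) ∧
      (∀ j, o = some j → (k : ℚ) * q i + q j = 1) ∧
      (o ≠ none → ∀ k : ℕ, (k : ℚ) * q i ≠ 1) := by
    intro i
    by_cases hi : ∃ m : ℕ, (m : ℚ) * q i = 1
    · obtain ⟨m, hm⟩ := hi
      exact ⟨none, m, by simp, fun _ => hm, by simp, by simp⟩
    · rcases exists_axis_charge hW hc i with h | ⟨j, hji, m, hm⟩
      · exact absurd h hi
      · exact ⟨some j, m, by simpa using hji, by simp, by rintro _ ⟨⟩; exact hm,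
          fun _ k hk => hi ⟨k, hk⟩⟩
  choose t m h1 h2 h3 h4 using h
  exact ⟨t, m, h1, h2, h3, h4⟩

/-! ### Feasible exponents from the charges -/

theorem three_le_of_root_charge {m : ℕ} {x : ℚ} (hx : x < 1 / 2) (h : (m : ℚ) * x = 1) :
    3 ≤ m := by
  by_contra! hm
  interval_cases m <;> norm_num at h <;> linarith

theorem two_le_of_pointer_charge {m : ℕ} {x y : ℚ} (hx : x < 1 / 2) (hy : y < 1 / 2)
    (h : (m : ℚ) * x + y = 1) : 2 ≤ m := by
  by_contra! hm
  interval_cases m <;> norm_num at h <;> linarith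

theorem isFeasible_of_charge {n : ℕ} {q : Fin n → ℚ} (hq : ∀ i, 0 < q i ∧ q i < 1 / 2)
    {t : Skeleton n} {m : Fin n → ℕ} (ht : ∀ i, t i ≠ some i)
    (h0 : ∀ i, t i = none → (m i : ℚ) * q i = 1)
    (h1 : ∀ i j, t i = some j → (m i : ℚ) * q i + q j = 1)
    (hlink : ∀ i j v, i ≠ j → i ≠ v → j ≠ v → ∃ a b : ℕ, (a : ℚ) * q i + (b : ℚ) * q j = 1) :
    IsFeasible t m q where
  root_exponent i hi := three_le_of_root_charge (hq i).2 (h0 i hi)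
  root_charge := h0
  pointer_exponent i j hi := two_le_of_pointer_charge (hq i).2 (hq j).2 (h1 i j hi)
  pointer_charge := h1
  link i j v hij hi hj := hlink i j v hij (fun h => ht i (h ▸ hi)) (fun h => ht j (h ▸ hj))

/-- Brings both alternatives to a common form. An indecomposable family receives a skeleton that
prefers roots, so that no pointer could be a root; an irreducible family already carries such a
skeleton. The links are a hypothesis because their source depends on `n`: for `n ≤ 2` there are no
three distinct nodes. -/
theorem exists_isFeasible {n : ℕ} {q : Fin n → ℚ} (hgc : GenericallyCompact q)
    (hirr : ¬ Decomposable q ∨ IrreducibleFamily q)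
    (hlink : ∀ W ∈ Family q, Compact W → ∀ i j v, i ≠ j → i ≠ v → j ≠ v →
      ∃ a b : ℕ, (a : ℚ) * q i + (b : ℚ) * q j = 1) :
    ∃ (t : Skeleton n) (m : Fin n → ℕ), (∀ i, t i ≠ some i) ∧ IsFeasible t m q ∧
      (∀ i, t i ≠ none → ∀ k : ℕ, (k : ℚ) * q i ≠ 1) ∧
      (¬ Decomposable q ∨ (t.Connected ∧ t.Irreducible q)) := by
  rcases hirr with hdec | ⟨W, hW, hc, t, m, ⟨h0, h1⟩, hconn, hirr⟩
  · obtain ⟨W, hW, hc⟩ := hgc.exists_compact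
    obtain ⟨t, m, ht, h0, h1, h2⟩ := exists_skeleton hW hc
    exact ⟨t, m, ht, isFeasible_of_charge hgc.1 ht h0 h1 (hlink W hW hc), h2, Or.inl hdec⟩
  · have ht : ∀ i, t i ≠ some i := fun i hi => (h1 i i hi).1 rfl
    refine ⟨t, m, ht, isFeasible_of_charge hgc.1 ht (fun i hi => ?_) (fun i j hi => ?_)
      (hlink W hW hc), hirr.2, Or.inr ⟨hconn, hirr⟩⟩
    · have := hW (h0 i hi)
      rwa [Finsupp.weight_single, nsmul_eq_mul] at this
    · have := hW (h1 i j hi).2.2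
      rwa [map_add, Finsupp.weight_single, Finsupp.weight_single, one_smul, nsmul_eq_mul] at this

/-! ### Relabelling the variables -/

section relabel

variable {n : ℕ} (σ : Equiv.Perm (Fin n)) {t t' : Skeleton n} {m : Fin n → ℕ} {q : Fin n → ℚ}

theorem chargesOf_comp (q : Fin n → ℚ) : chargesOf (q ∘ σ) = chargesOf q := by
  unfold chargesOf
  rw [← Multiset.map_map]
  congr 1
  simp

theorem centralCharge_comp (q : Fin n → ℚ) : centralCharge (q ∘ σ) = centralCharge q := by
  unfold centralCharge
  congr 1
  exact Equiv.sum_comp σ fun i => 1 - 2 * q i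

theorem eq_none_of_relabel (h : ∀ i, t (σ i) = (t' i).map σ) {i : Fin n} (hi : t' i = none) :
    t (σ i) = none := by
  rw [h, hi, Option.map_none]

theorem eq_some_of_relabel (h : ∀ i, t (σ i) = (t' i).map σ) {i j : Fin n} (hi : t' i = some j) :
    t (σ i) = some (σ j) := by
  rw [h, hi, Option.map_some]

theorem IsFeasible.relabel (hf : IsFeasible t m q) (h : ∀ i, t (σ i) = (t' i).map σ) :
    IsFeasible t' (m ∘ σ) (q ∘ σ) where
  root_exponent _ hi := hf.root_exponent _ (eq_none_of_relabel σ h hi)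
  root_charge _ hi := hf.root_charge _ (eq_none_of_relabel σ h hi)
  pointer_exponent _ _ hi := hf.pointer_exponent _ _ (eq_some_of_relabel σ h hi)
  pointer_charge _ _ hi := hf.pointer_charge _ _ (eq_some_of_relabel σ h hi)
  link _ _ _ hij hi hj := hf.link _ _ _ (σ.injective.ne hij) (eq_some_of_relabel σ h hi)
    (eq_some_of_relabel σ h hj)

theorem irreducible_relabel (h0 : ∀ i j, t' i = none → t' j = none → i = j)
    (hq : ∀ i, t i ≠ none → ∀ k : ℕ, (k : ℚ) * q i ≠ 1) (h : ∀ i, t (σ i) = (t' i).map σ) :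
    t'.Irreducible (q ∘ σ) :=
  ⟨h0, fun i hi k => hq (σ i) (by rw [h]; simpa using hi) k⟩

end relabel

/-! Decomposable families. -/

theorem isWeightedHomogeneous_X_pow {n : ℕ} (q : Fin n → ℚ) {i : Fin n} {a : ℕ}
    (h : (a : ℚ) * q i = 1) : IsWeightedHomogeneous q (X i ^ a : MvPolynomial (Fin n) ℂ) 1 := by
  simpa [h] using (isWeightedHomogeneous_X ℂ q i).pow a

theorem isWeightedHomogeneous_X_pow_mul_X_pow {n : ℕ} (q : Fin n → ℚ) {i j : Fin n} {a e : ℕ}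
    (h : (a : ℚ) * q i + e * q j = 1) :
    IsWeightedHomogeneous q (X i ^ a * X j ^ e : MvPolynomial (Fin n) ℂ) 1 := by
  simpa [h] using ((isWeightedHomogeneous_X ℂ q i).pow a).mul ((isWeightedHomogeneous_X ℂ q j).pow e)

theorem X_pow_mem_supported {n : ℕ} {A : Set (Fin n)} {i : Fin n} (hi : i ∈ A) (a : ℕ) :
    (X i ^ a : MvPolynomial (Fin n) ℂ) ∈ supported ℂ A :=
  pow_mem (X_mem_supported.2 hi) a

theorem decomposable_of_two_roots {q : Fin 2 → ℚ} {a b : ℕ} (ha : 3 ≤ a) (hb : 3 ≤ b)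
    (h0 : (a : ℚ) * q 0 = 1) (h1 : (b : ℚ) * q 1 = 1) : Decomposable q := by
  refine ⟨X 0 ^ a + X 1 ^ b, ?_, ?_, {0}, ⟨0, rfl⟩, ⟨1, by simp⟩, X 0 ^ a,
    X_pow_mem_supported (by simp) a, X 1 ^ b, X_pow_mem_supported (by simp) b, rfl⟩
  · exact (isWeightedHomogeneous_X_pow q h0).add (isWeightedHomogeneous_X_pow q h1)
  · intro x
    have e0 : eval x (pderiv 0 (X 0 ^ a + X 1 ^ b : MvPolynomial (Fin 2) ℂ)) =
        a * x 0 ^ (a - 1) := by simp [pderiv_X]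
    have e1 : eval x (pderiv 1 (X 0 ^ a + X 1 ^ b : MvPolynomial (Fin 2) ℂ)) =
        b * x 1 ^ (b - 1) := by simp [pderiv_X]
    rw [Fin.forall_fin_two, e0, e1]
    constructor
    · rintro ⟨h, h'⟩
      have h : x 0 = 0 := by
        simpa [show a ≠ 0 by omega, show a - 1 ≠ 0 by omega] using h
      have h' : x 1 = 0 := by
        simpa [show b ≠ 0 by omega, show b - 1 ≠ 0 by omega] using h'
      ext k
      fin_cases k <;> assumption
    · rintro rfl
      simp [show a - 1 ≠ 0 by omega, show b - 1 ≠ 0 by omega]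

/-- `X_i ^ a` plus a Fermat, chain or loop polynomial in the two other variables is compact. -/
theorem decomposable_of_root_add {q : Fin 3 → ℚ} {i j k : Fin 3} (hij : i ≠ j) (hik : i ≠ k)
    (hjk : j ≠ k) {a b c e f : ℕ} (ha : 2 ≤ a) (hb : 2 ≤ b) (hc : 2 ≤ c)
    (hef : e = 0 ∧ f = 0 ∨ e = 1 ∧ f = 0 ∨ e = 1 ∧ f = 1) (hi : (a : ℚ) * q i = 1)
    (hj : (b : ℚ) * q j + e * q k = 1) (hk : (c : ℚ) * q k + f * q j = 1) : Decomposable q := by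
  refine ⟨X i ^ a + (X j ^ b * X k ^ e + X k ^ c * X j ^ f), ?_, ?_, {i}, ⟨i, rfl⟩,
    ⟨j, by simp [hij.symm]⟩, X i ^ a, X_pow_mem_supported (by simp) a, _, ?_, rfl⟩
  · exact (isWeightedHomogeneous_X_pow q hi).add
      ((isWeightedHomogeneous_X_pow_mul_X_pow q hj).add
        (isWeightedHomogeneous_X_pow_mul_X_pow q hk))
  · intro x
    set W : MvPolynomial (Fin 3) ℂ := X i ^ a + (X j ^ b * X k ^ e + X k ^ c * X j ^ f) with hW
    have ei : eval x (pderiv i W) = a * x i ^ (a - 1) := by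
      simp [hW, pderiv_X, hij.symm, hik.symm]
    have ej : eval x (pderiv j W) =
        b * x j ^ (b - 1) * x k ^ e + x k ^ c * (f * x j ^ (f - 1)) := by
      simp [hW, pderiv_X, hij, hjk.symm]
      ring
    have ek : eval x (pderiv k W) =
        x j ^ b * (e * x k ^ (e - 1)) + c * x k ^ (c - 1) * x j ^ f := by
      simp [hW, pderiv_X, hik, hjk]
      ring
    have hall : (∀ l, eval x (pderiv l W) = 0) ↔ eval x (pderiv i W) = 0 ∧
        eval x (pderiv j W) = 0 ∧ eval x (pderiv k W) = 0 := by
      refine ⟨fun h => ⟨h i, h j, h k⟩, fun h l => ?_⟩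
      rcases eq_of_distinct hij hik hjk l with rfl | rfl | rfl
      exacts [h.1, h.2.1, h.2.2]
    have hx : x = 0 ↔ x i = 0 ∧ x j = 0 ∧ x k = 0 := by
      refine ⟨by rintro rfl; simp, fun h => ?_⟩
      ext l
      rcases eq_of_distinct hij hik hjk l with rfl | rfl | rfl
      exacts [h.1, h.2.1, h.2.2]
    rw [hall, hx, ei, ej, ek]
    have ha' : a - 1 ≠ 0 := by omega
    have hb' : b - 1 ≠ 0 := by omega
    have hc' : c - 1 ≠ 0 := by omega
    have ha0 : a ≠ 0 := by omega
    have hb0 : b ≠ 0 := by omega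
    have hc0 : c ≠ 0 := by omega
    rcases hef with ⟨rfl, rfl⟩ | ⟨rfl, rfl⟩ | ⟨rfl, rfl⟩
    · simp [ha', hb', hc', ha0, hb0, hc0]
    · constructor
      · rintro ⟨h1, h2, h3⟩
        have h1 : x i = 0 := by simpa [ha', ha0] using h1
        have h2 : x j = 0 ∨ x k = 0 := by simpa [hb', hb0] using h2
        refine ⟨h1, ?_⟩
        rcases h2 with h | h
        · exact ⟨h, by simpa [h, hc', hc0, hb0] using h3⟩
        · exact ⟨by simpa [h, hc', hc0, hb0] using h3, h⟩
      · rintro ⟨h1, h2, h3⟩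
        simp [h1, h2, h3, ha', hb', hc', hb0]
    · constructor
      · rintro ⟨h1, h2, h3⟩
        have h1 : x i = 0 := by simpa [ha', ha0] using h1
        refine ⟨h1, ?_⟩
        simp only [pow_one, Nat.cast_one, Nat.sub_self, pow_zero, mul_one] at h2 h3
        by_cases hxj : x j = 0
        · exact ⟨hxj, by simpa [hxj, hb', hc0] using h2⟩
        by_cases hxk : x k = 0
        · exact ⟨by simpa [hxk, hc', hb0] using h3, hxk⟩
        exfalso
        obtain ⟨b, rfl⟩ : ∃ b', b = b' + 1 := ⟨b - 1, by omega⟩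
        obtain ⟨c, rfl⟩ : ∃ c', c = c' + 1 := ⟨c - 1, by omega⟩
        simp only [Nat.add_sub_cancel] at *
        have h2 : ((b + 1 : ℕ) : ℂ) * x j ^ b + x k ^ c = 0 :=
          (mul_eq_zero.1 (by linear_combination h2 :
            x k * (((b + 1 : ℕ) : ℂ) * x j ^ b + x k ^ c) = 0)).resolve_left hxk
        have h3 : x j ^ b + ((c + 1 : ℕ) : ℂ) * x k ^ c = 0 :=
          (mul_eq_zero.1 (by linear_combination h3 :
            x j * (x j ^ b + ((c + 1 : ℕ) : ℂ) * x k ^ c) = 0)).resolve_left hxj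
        -- The two equations are linear in `x j ^ b` and `x k ^ c`, with determinant `(b + 1) * (c +
        -- 1) - 1`, which is nonzero.
        have h4 : (((b + 1) * (c + 1) - 1 : ℤ) : ℂ) * x k ^ c = 0 := by
          push_cast at h2 h3 ⊢
          linear_combination (b + 1 : ℂ) * h3 - h2
        rcases mul_eq_zero.1 h4 with h | h
        · have h : ((b : ℤ) + 1) * (c + 1) - 1 = 0 := by exact_mod_cast h
          have : 0 < b := by omega
          have : 0 < c := by omega
          nlinarith
        · exact hxk (pow_eq_zero_iff hc' |>.1 h)
      · rintro ⟨h1, h2, h3⟩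
        simp [h1, h2, h3, ha', hb0, hc0]
  · have hj' : j ∈ ({i} : Set (Fin 3))ᶜ := by simp [hij.symm]
    have hk' : k ∈ ({i} : Set (Fin 3))ᶜ := by simp [hik.symm]
    exact add_mem (mul_mem (X_pow_mem_supported hj' b) (X_pow_mem_supported hk' e))
      (mul_mem (X_pow_mem_supported hk' c) (X_pow_mem_supported hj' f))

/-! Classification of the graphs. -/

theorem classify_two : ∀ t : Skeleton 2, (∀ i, t i ≠ some i) →
    (t 0 = none ∧ t 1 = none) ∨ ∃ σ : Equiv.Perm (Fin 2),
      (∀ i, t (σ i) = (S21 i).map σ) ∨ (∀ i, t (σ i) = (S22 i).map σ) := by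
  decide +kernel

/-- There are 27 maps without fixed points. The first two alternatives are the disconnected shapes:
an isolated root beside a Fermat, chain or loop pair. The rest are the four connected skeletons. -/
theorem classify_three : ∀ t : Skeleton 3, (∀ i, t i ≠ some i) → ∃ σ : Equiv.Perm (Fin 3),
    (t (σ 0) = none ∧ (t (σ 1) = none ∨ t (σ 1) = some (σ 2)) ∧ t (σ 2) = none) ∨
    (t (σ 0) = none ∧ t (σ 1) = some (σ 2) ∧ t (σ 2) = some (σ 1)) ∨
    (∀ i, t (σ i) = (S31 i).map σ) ∨ (∀ i, t (σ i) = (S32 i).map σ) ∨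
    (∀ i, t (σ i) = (S33 i).map σ) ∨ (∀ i, t (σ i) = (S34 i).map σ) := by
  decide +kernel

theorem Skeleton.Connected.exists_arrow {n : ℕ} {t : Skeleton (n + 2)} (h : t.Connected)
    (i : Fin (n + 2)) : ∃ j, t i = some j ∨ t j = some i := by
  obtain ⟨j, hj⟩ := h.preconnected.exists_adj_of_nontrivial i
  exact ⟨j, ((SimpleGraph.fromRel_adj _ _ _).1 hj).2⟩

theorem irreducible_charges_two {q : Fin 2 → ℚ} (hgc : GenericallyCompact q)
    (hirr : ¬ Decomposable q ∨ IrreducibleFamily q) :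
    ∃ (m : Fin 2 → ℕ) (q' : Fin 2 → ℚ), chargesOf q' = chargesOf q ∧
      centralCharge q' = centralCharge q ∧ (IsFeasible S21 m q' ∨ IsFeasible S22 m q') := by
  obtain ⟨t, m, ht, hf, hp, h⟩ := exists_isFeasible hgc hirr
    (fun _ _ _ i j v hij hiv hjv => by omega)
  rcases classify_two t ht with ⟨h0, h1⟩ | ⟨σ, hσ⟩
  · exfalso
    rcases h with h | h
    · exact h (decomposable_of_two_roots (hf.root_exponent 0 h0) (hf.root_exponent 1 h1)
        (hf.root_charge 0 h0) (hf.root_charge 1 h1))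
    · exact absurd (h.2.1 0 1 h0 h1) (by decide)
  · exact ⟨m ∘ σ, q ∘ σ, chargesOf_comp σ q, centralCharge_comp σ q, hσ.imp (hf.relabel σ) (hf.relabel σ)⟩

/-- The disconnected shapes are ruled out by `decomposable_of_root_add` if the family is
indecomposable. If it is irreducible, the shapes with two roots violate irreducibility, and an
isolated root beside a loop violates connectedness. -/
theorem irreducible_charges_three {q : Fin 3 → ℚ} (hgc : GenericallyCompact q)
    (hirr : ¬ Decomposable q ∨ IrreducibleFamily q) (hc : centralCharge q < 6) :
    ∃ (m : Fin 3 → ℕ) (q' : Fin 3 → ℚ), chargesOf q' = chargesOf q ∧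
      (IsIrreducibleExponent S31 m q' ∨ IsIrreducibleExponent S32 m q' ∨
        IsIrreducibleExponent S33 m q' ∨ IsIrreducibleExponent S34 m q') := by
  obtain ⟨t, m, ht, hf, hp, h⟩ := exists_isFeasible hgc hirr
    (fun W hW hc i j v hij hiv hjv => exists_link_charge hW hc (hgc.1 i).1
      (by linarith [(hgc.1 v).2]) hij hiv hjv)
  obtain ⟨σ, hσ⟩ := classify_three t ht
  have h01 : σ 0 ≠ σ 1 := σ.injective.ne (by decide)
  have h02 : σ 0 ≠ σ 2 := σ.injective.ne (by decide)
  have h12 : σ 1 ≠ σ 2 := σ.injective.ne (by decide)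
  have main : ∀ S : Skeleton 3, (∀ i j, S i = none → S j = none → i = j) →
      (∀ i, t (σ i) = (S i).map σ) → IsIrreducibleExponent S (m ∘ σ) (q ∘ σ) := fun S hS h =>
    ⟨hf.relabel σ h, irreducible_relabel σ hS hp h, (centralCharge_comp σ q).trans_lt hc⟩
  refine ⟨m ∘ σ, q ∘ σ, chargesOf_comp σ q, ?_⟩
  rcases hσ with ⟨h0, h1, h2⟩ | ⟨h0, h1, h2⟩ | hσ | hσ | hσ | hσ
  · exfalso
    rcases h with h | h
    · have r0 := hf.root_exponent _ h0
      have r2 := hf.root_exponent _ h2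
      rcases h1 with h1 | h1
      · have r1 := hf.root_exponent _ h1
        refine h (decomposable_of_root_add (a := m (σ 0)) (b := m (σ 1)) (c := m (σ 2)) (e := 0)
          (f := 0) h01 h02 h12 (by omega) (by omega) (by omega) (by simp)
          (hf.root_charge _ h0) ?_ ?_)
        · simpa using hf.root_charge _ h1
        · simpa using hf.root_charge _ h2
      · refine h (decomposable_of_root_add (a := m (σ 0)) (b := m (σ 1)) (c := m (σ 2)) (e := 1)
          (f := 0) h01 h02 h12 (by omega) (hf.pointer_exponent _ _ h1) (by omega) (by simp)
          (hf.root_charge _ h0) ?_ ?_)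
        · simpa using hf.pointer_charge _ _ h1
        · simpa using hf.root_charge _ h2
    · exact h02 (h.2.1 _ _ h0 h2)
  · exfalso
    rcases h with h | h
    · have r0 := hf.root_exponent _ h0
      refine h (decomposable_of_root_add (a := m (σ 0)) (b := m (σ 1)) (c := m (σ 2)) (e := 1)
        (f := 1) h01 h02 h12 (by omega) (hf.pointer_exponent _ _ h1) (hf.pointer_exponent _ _ h2)
        (by simp) (hf.root_charge _ h0) ?_ ?_)
      · simpa using hf.pointer_charge _ _ h1
      · simpa using hf.pointer_charge _ _ h2
    · obtain ⟨j, hj | hj⟩ := h.1.exists_arrow (σ 0)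
      · simp [h0] at hj
      · rcases eq_of_distinct h01 h02 h12 j with rfl | rfl | rfl
        · simp [h0] at hj
        · rw [h1, Option.some_inj] at hj
          exact h02 hj.symm
        · rw [h2, Option.some_inj] at hj
          exact h01 hj.symm
  · exact Or.inl (main _ (by decide) hσ)
  · exact Or.inr (Or.inl (main _ (by decide) hσ))
  · exact Or.inr (Or.inr (Or.inl (main _ (by decide) hσ)))
  · exact Or.inr (Or.inr (Or.inr (main _ (by decide) hσ)))

/-! Charges with a common denominator. -/

theorem chargesOf_one (q : Fin 1 → ℚ) : chargesOf q = {q 0} := rfl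

theorem chargesOf_two (q : Fin 2 → ℚ) : chargesOf q = {q 0, q 1} := rfl

theorem chargesOf_three (q : Fin 3 → ℚ) : chargesOf q = {q 0, q 1, q 2} := rfl

theorem centralCharge_lt_six_iff (q : Fin 3 → ℚ) :
    centralCharge q < 6 ↔ 1 / 2 < q 0 + q 1 + q 2 := by
  unfold centralCharge
  rw [Fin.sum_univ_three]
  constructor <;> intro h <;> linarith

theorem forall_mul_div_ne_one_iff {N d : ℕ} (hd : 0 < d) :
    (∀ k : ℕ, (k : ℚ) * ((N : ℚ) / d) ≠ 1) ↔ ¬ N ∣ d := by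
  have hd' : (d : ℚ) ≠ 0 := by exact_mod_cast hd.ne'
  have key : ∀ k : ℕ, (k : ℚ) * ((N : ℚ) / d) = 1 ↔ d = N * k := by
    intro k
    rw [← mul_div_assoc, div_eq_one_iff_eq hd', mul_comm]
    constructor
    · intro h; exact_mod_cast h.symm
    · intro h; exact_mod_cast h.symm
  simp only [ne_eq, key, Dvd.dvd, not_exists]

theorem mul_div_eq_one_iff {a N d : ℕ} (hd : 0 < d) : (a : ℚ) * ((N : ℚ) / d) = 1 ↔ a * N = d := by
  have hd' : (d : ℚ) ≠ 0 := by exact_mod_cast hd.ne'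
  rw [← mul_div_assoc, div_eq_one_iff_eq hd']
  exact_mod_cast Iff.rfl

theorem mul_div_add_mul_div_eq_one_iff {a b N M d : ℕ} (hd : 0 < d) :
    (a : ℚ) * ((N : ℚ) / d) + (b : ℚ) * ((M : ℚ) / d) = 1 ↔ a * N + b * M = d := by
  have hd' : (d : ℚ) ≠ 0 := by exact_mod_cast hd.ne'
  rw [← mul_div_assoc, ← mul_div_assoc, ← add_div, div_eq_one_iff_eq hd']
  exact_mod_cast Iff.rfl

theorem mul_div_add_div_eq_one_iff {a N M d : ℕ} (hd : 0 < d) :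
    (a : ℚ) * ((N : ℚ) / d) + (M : ℚ) / d = 1 ↔ a * N + M = d := by
  simpa using mul_div_add_mul_div_eq_one_iff (a := a) (b := 1) (N := N) (M := M) hd

/-- The feasibility conditions on the numerators `N i` of charges `N i / d`. -/
theorem isFeasible_div_iff {n : ℕ} {t : Skeleton n} {m N : Fin n → ℕ} {d : ℕ} (hd : 0 < d) :
    IsFeasible t m (fun i => (N i : ℚ) / d) ↔
      (∀ i, t i = none → 3 ≤ m i ∧ m i * N i = d) ∧
      (∀ i j, t i = some j → 2 ≤ m i ∧ m i * N i + N j = d) ∧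
      (∀ i j v, i ≠ j → t i = some v → t j = some v → ∃ a b : ℕ, a * N i + b * N j = d) := by
  constructor
  · intro h
    refine ⟨fun i hi => ⟨h.1 i hi, (mul_div_eq_one_iff hd).1 (h.2 i hi)⟩,
      fun i j hi => ⟨h.3 i j hi, (mul_div_add_div_eq_one_iff hd).1 (h.4 i j hi)⟩,
      fun i j v hij hi hj => ?_⟩
    obtain ⟨a, b, hab⟩ := h.5 i j v hij hi hj
    exact ⟨a, b, (mul_div_add_mul_div_eq_one_iff hd).1 hab⟩
  · rintro ⟨h1, h2, h3⟩
    refine ⟨fun i hi => (h1 i hi).1, fun i hi => (mul_div_eq_one_iff hd).2 (h1 i hi).2,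
      fun i j hi => (h2 i j hi).1, fun i j hi => (mul_div_add_div_eq_one_iff hd).2 (h2 i j hi).2,
      fun i j v hij hi hj => ?_⟩
    obtain ⟨a, b, hab⟩ := h3 i j v hij hi hj
    exact ⟨a, b, (mul_div_add_mul_div_eq_one_iff hd).2 hab⟩

theorem irreducible_div_iff {n : ℕ} {t : Skeleton n} {N : Fin n → ℕ} {d : ℕ} (hd : 0 < d) :
    t.Irreducible (fun i => (N i : ℚ) / d) ↔ (∀ i j, t i = none → t j = none → i = j) ∧
      ∀ i, t i ≠ none → ¬ N i ∣ d := by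
  unfold Skeleton.Irreducible
  simp only [forall_mul_div_ne_one_iff hd]

theorem centralCharge_div_lt_six_iff {N : Fin 3 → ℕ} {d : ℕ} (hd : 0 < d) :
    centralCharge (fun i => (N i : ℚ) / d) < 6 ↔ d < 2 * (N 0 + N 1 + N 2) := by
  have hd' : (0 : ℚ) < d := by exact_mod_cast hd
  rw [centralCharge_lt_six_iff, ← add_div, ← add_div, div_lt_div_iff₀ two_pos hd', one_mul, mul_comm]
  exact_mod_cast Iff.rfl

theorem vec_div_eq (x y z d : ℕ) : (![(x : ℚ) / d, (y : ℚ) / d, (z : ℚ) / d] : Fin 3 → ℚ) =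
    fun i => ((![x, y, z] i : ℕ) : ℚ) / d := by
  ext i
  fin_cases i <;> rfl

theorem isFeasible_S31_div_iff {m : Fin 3 → ℕ} {x y z d : ℕ} (hd : 0 < d) :
    IsFeasible S31 m ![(x : ℚ) / d, (y : ℚ) / d, (z : ℚ) / d] ↔
      (3 ≤ m 2 ∧ m 2 * z = d) ∧ (2 ≤ m 0 ∧ m 0 * x + y = d) ∧ (2 ≤ m 1 ∧ m 1 * y + z = d) := by
  rw [vec_div_eq, isFeasible_div_iff hd]
  simp [Fin.forall_fin_succ, S31]

theorem isIrreducibleExponent_S31_div_iff {m : Fin 3 → ℕ} {x y z d : ℕ} (hd : 0 < d) :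
    IsIrreducibleExponent S31 m ![(x : ℚ) / d, (y : ℚ) / d, (z : ℚ) / d] ↔
      ((3 ≤ m 2 ∧ m 2 * z = d) ∧ (2 ≤ m 0 ∧ m 0 * x + y = d) ∧ (2 ≤ m 1 ∧ m 1 * y + z = d)) ∧
      (¬ x ∣ d ∧ ¬ y ∣ d) ∧ d < 2 * (x + y + z) := by
  unfold IsIrreducibleExponent
  rw [isFeasible_S31_div_iff hd, vec_div_eq, irreducible_div_iff hd,
    centralCharge_div_lt_six_iff hd]
  simp [Fin.forall_fin_succ, S31]

theorem isIrreducibleExponent_S32_div_iff {m : Fin 3 → ℕ} {x y z d : ℕ} (hd : 0 < d) :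
    IsIrreducibleExponent S32 m ![(x : ℚ) / d, (y : ℚ) / d, (z : ℚ) / d] ↔
      ((3 ≤ m 1 ∧ m 1 * y = d) ∧ (2 ≤ m 0 ∧ m 0 * x + y = d) ∧ (2 ≤ m 2 ∧ m 2 * z + y = d) ∧
        ∃ a b : ℕ, a * x + b * z = d) ∧
      (¬ x ∣ d ∧ ¬ z ∣ d) ∧ d < 2 * (x + y + z) := by
  have hs : (∃ a b : ℕ, a * z + b * x = d) ↔ ∃ a b : ℕ, a * x + b * z = d :=
    ⟨fun ⟨a, b, h⟩ => ⟨b, a, by omega⟩, fun ⟨a, b, h⟩ => ⟨b, a, by omega⟩⟩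
  unfold IsIrreducibleExponent
  rw [vec_div_eq, isFeasible_div_iff hd, irreducible_div_iff hd, centralCharge_div_lt_six_iff hd]
  simp [Fin.forall_fin_succ, S32, hs, and_assoc]

theorem isFeasible_S33_div_iff {m : Fin 3 → ℕ} {x y z d : ℕ} (hd : 0 < d) :
    IsFeasible S33 m ![(x : ℚ) / d, (y : ℚ) / d, (z : ℚ) / d] ↔
      (2 ≤ m 0 ∧ m 0 * x + y = d) ∧ (2 ≤ m 1 ∧ m 1 * y + z = d) ∧ (2 ≤ m 2 ∧ m 2 * z + x = d) := by
  rw [vec_div_eq, isFeasible_div_iff hd]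
  simp [Fin.forall_fin_succ, S33]

theorem isIrreducibleExponent_S33_div_iff {m : Fin 3 → ℕ} {x y z d : ℕ} (hd : 0 < d) :
    IsIrreducibleExponent S33 m ![(x : ℚ) / d, (y : ℚ) / d, (z : ℚ) / d] ↔
      ((2 ≤ m 0 ∧ m 0 * x + y = d) ∧ (2 ≤ m 1 ∧ m 1 * y + z = d) ∧ (2 ≤ m 2 ∧ m 2 * z + x = d)) ∧
      (¬ x ∣ d ∧ ¬ y ∣ d ∧ ¬ z ∣ d) ∧ d < 2 * (x + y + z) := by
  unfold IsIrreducibleExponent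
  rw [isFeasible_S33_div_iff hd, vec_div_eq, irreducible_div_iff hd,
    centralCharge_div_lt_six_iff hd]
  simp [Fin.forall_fin_succ, S33]

theorem isIrreducibleExponent_S34_div_iff {m : Fin 3 → ℕ} {x y z d : ℕ} (hd : 0 < d) :
    IsIrreducibleExponent S34 m ![(x : ℚ) / d, (y : ℚ) / d, (z : ℚ) / d] ↔
      ((2 ≤ m 0 ∧ m 0 * x + y = d) ∧ (2 ≤ m 1 ∧ m 1 * y + x = d) ∧ (2 ≤ m 2 ∧ m 2 * z + y = d) ∧
        ∃ a b : ℕ, a * x + b * z = d) ∧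
      (¬ x ∣ d ∧ ¬ y ∣ d ∧ ¬ z ∣ d) ∧ d < 2 * (x + y + z) := by
  have hs : (∃ a b : ℕ, a * z + b * x = d) ↔ ∃ a b : ℕ, a * x + b * z = d :=
    ⟨fun ⟨a, b, h⟩ => ⟨b, a, by omega⟩, fun ⟨a, b, h⟩ => ⟨b, a, by omega⟩⟩
  unfold IsIrreducibleExponent
  rw [vec_div_eq, isFeasible_div_iff hd, irreducible_div_iff hd, centralCharge_div_lt_six_iff hd]
  simp [Fin.forall_fin_succ, S34, hs, and_assoc]

/-! Recognizing sporadic charges. -/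

/-- `x / d`, `y / d`, `z / d` is, in some order, an entry of the list of sporadic charges. -/
def sporadicTest (x y z d : ℕ) : Bool :=
  sporadicData.any fun p =>
    -- The equality of sums follows from the remaining conditions; tested first, it rejects most
    -- entries before the six orders are tried.
    Nat.beq ((x + y + z) * p.2.2.2) ((p.1 + p.2.1 + p.2.2.1) * d) &&
    ((Nat.beq (x * p.2.2.2) (p.1 * d) &&
        ((Nat.beq (y * p.2.2.2) (p.2.1 * d) && Nat.beq (z * p.2.2.2) (p.2.2.1 * d)) ||
        (Nat.beq (z * p.2.2.2) (p.2.1 * d) && Nat.beq (y * p.2.2.2) (p.2.2.1 * d)))) ||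
      (Nat.beq (y * p.2.2.2) (p.1 * d) &&
        ((Nat.beq (x * p.2.2.2) (p.2.1 * d) && Nat.beq (z * p.2.2.2) (p.2.2.1 * d)) ||
        (Nat.beq (z * p.2.2.2) (p.2.1 * d) && Nat.beq (x * p.2.2.2) (p.2.2.1 * d)))) ||
      (Nat.beq (z * p.2.2.2) (p.1 * d) &&
        ((Nat.beq (x * p.2.2.2) (p.2.1 * d) && Nat.beq (y * p.2.2.2) (p.2.2.1 * d)) ||
        (Nat.beq (y * p.2.2.2) (p.2.1 * d) && Nat.beq (x * p.2.2.2) (p.2.2.1 * d)))))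

theorem sporadicData_pos : ∀ p ∈ sporadicData, 0 < p.2.2.2 := by
  decide +kernel

theorem div_eq_div_of_mul_eq {x a d e : ℕ} (hd : 0 < d) (he : 0 < e) (h : x * e = a * d) :
    (x : ℚ) / d = (a : ℚ) / e := by
  rw [div_eq_div_iff (by positivity) (by positivity)]
  exact_mod_cast h

theorem multiset_rotate (x y z : ℚ) : ({x, y, z} : Multiset ℚ) = {y, z, x} := by
  simp only [Multiset.insert_eq_cons]
  rw [Multiset.cons_swap, ← Multiset.cons_zero z, Multiset.cons_swap x z, Multiset.cons_zero]

theorem multiset_swap (x y z : ℚ) : ({x, y, z} : Multiset ℚ) = {y, x, z} :=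
  Multiset.cons_swap _ _ _

theorem multiset_swap_right (x y z : ℚ) : ({x, y, z} : Multiset ℚ) = {x, z, y} := by
  rw [multiset_rotate, multiset_rotate, multiset_swap]

theorem mem_sporadicCharges_of_test {x y z d : ℕ} (hd : 0 < d) (h : sporadicTest x y z d = true) :
    ({(x : ℚ) / d, (y : ℚ) / d, (z : ℚ) / d} : Multiset ℚ) ∈ sporadicCharges := by
  unfold sporadicTest at h
  rw [List.any_eq_true] at h
  obtain ⟨⟨a, b, c, e⟩, hp, h⟩ := h
  have he : 0 < e := sporadicData_pos _ hp
  refine ⟨a, b, c, e, hp, ?_⟩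
  simp only [Bool.and_eq_true, Bool.or_eq_true, Nat.beq_eq] at h
  have H := fun {x a : ℕ} => div_eq_div_of_mul_eq (x := x) (a := a) hd he
  obtain ⟨-, (⟨h1, ⟨h2, h3⟩ | ⟨h2, h3⟩⟩ | ⟨h1, ⟨h2, h3⟩ | ⟨h2, h3⟩⟩) |
    ⟨h1, ⟨h2, h3⟩ | ⟨h2, h3⟩⟩⟩ := h <;> rw [← H h1, ← H h2, ← H h3]
  · exact multiset_swap_right _ _ _
  · exact multiset_swap _ _ _
  · exact multiset_rotate _ _ _
  · exact (multiset_rotate _ _ _).symm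
  · rw [multiset_rotate, multiset_swap]

/-- `f` holds on the box `[0, A) × [0, B) × [0, C)`. -/
def allBelow (A B C : ℕ) (f : ℕ → ℕ → ℕ → Bool) : Bool :=
  (List.range A).all fun a => (List.range B).all fun b => (List.range C).all fun c => f a b c

theorem allBelow_apply {A B C : ℕ} {f : ℕ → ℕ → ℕ → Bool} (h : allBelow A B C f = true)
    {a b c : ℕ} (ha : a < A) (hb : b < B) (hc : c < C) : f a b c = true := by
  simp only [allBelow, List.all_eq_true, List.mem_range] at h
  exact h a ha b hb c hc

theorem triple_congr {x y z x' y' z' : ℚ} (hx : x = x') (hy : y = y') (hz : z = z') :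
    ({x, y, z} : Multiset ℚ) = {x', y', z'} := by
  rw [hx, hy, hz]

attribute [irreducible] sporadicTest allBelow

/-! The graph `X₁ → X₂ → X₃` with root `X₃`. -/

/-- The numerators belong to irreducible exponents on `S31` outside the infinite families. -/
def Candidate31 (a b c : ℕ) : Prop :=
  2 < (b - 2) * (c - 2) ∧ 4 < (a - 2) * (c - 2) ∧ 2 < (a - 2) * (b - 2) ∧
    a * b * c < 2 * ((b - 1) * c + 1 + a * (c - 1) + a * b) ∧
    ¬ (b - 1) * c + 1 ∣ a * b * c ∧ ¬ a * (c - 1) ∣ a * b * c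

instance (a b c : ℕ) : Decidable (Candidate31 a b c) := by
  unfold Candidate31
  infer_instance

theorem sporadicTest_of_candidate31 : allBelow 30 24 30 (fun a b c =>
    !decide (Candidate31 a b c) ||
      sporadicTest ((b - 1) * c + 1) (a * (c - 1)) (a * b) (a * b * c)) = true := by
  decide +kernel


theorem eq_of_isFeasible_S31 {m : Fin 3 → ℕ} {q : Fin 3 → ℚ} (h : IsFeasible S31 m q) :
    q = ![(((m 1 - 1) * m 2 + 1 : ℕ) : ℚ) / (m 0 * m 1 * m 2 : ℕ),
      ((m 0 * (m 2 - 1) : ℕ) : ℚ) / (m 0 * m 1 * m 2 : ℕ),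
      ((m 0 * m 1 : ℕ) : ℚ) / (m 0 * m 1 * m 2 : ℕ)] := by
  have ha := h.pointer_exponent 0 1 rfl
  have hb := h.pointer_exponent 1 2 rfl
  have hc := h.root_exponent 2 rfl
  have e0 := h.pointer_charge 0 1 rfl
  have e1 := h.pointer_charge 1 2 rfl
  have e2 := h.root_charge 2 rfl
  obtain ⟨b, hb'⟩ : ∃ b, m 1 = b + 1 := ⟨m 1 - 1, by omega⟩
  obtain ⟨c, hc'⟩ : ∃ c, m 2 = c + 1 := ⟨m 2 - 1, by omega⟩
  rw [hb'] at e1 ⊢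
  rw [hc'] at e2 ⊢
  generalize m 0 = a at *
  have ha0 : (a : ℚ) ≠ 0 := by norm_cast; omega
  push_cast at *
  have hb0 : (b : ℚ) + 1 ≠ 0 := by positivity
  have hc0 : (c : ℚ) + 1 ≠ 0 := by positivity
  ext i
  fin_cases i <;> simp <;> rw [eq_div_iff (by positivity)]
  · linear_combination (b + 1 : ℚ) * (c + 1) * e0 - (c + 1 : ℚ) * e1 + e2
  · linear_combination (a : ℚ) * (c + 1) * e1 - (a : ℚ) * e2
  · linear_combination (a : ℚ) * (b + 1) * e2

/-- The charge inequality is linear in each exponent: the coefficient of `a` is `(b - 2) * (c - 2) -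
2`, that of `b` is `(a - 2) * (c - 2) - 4`, that of `c` is `(a - 2) * (b - 2) - 2`. The hypotheses
make all three positive, so each exponent is less than a quotient that is largest when its
coefficient is `1`. For `b` the extreme pairs are `{a, c} = {3, 7}`, giving `24`; the bounds for `a`
and `c` are not sharp. -/
theorem bounds_S31 {a b c : ℕ} (h1 : 2 < (b - 2) * (c - 2)) (h2 : 4 < (a - 2) * (c - 2))
    (h3 : 2 < (a - 2) * (b - 2))
    (h : a * b * c < 2 * ((b - 1) * c + 1 + a * (c - 1) + a * b)) :
    a < 30 ∧ b < 24 ∧ c < 30 := by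
  obtain ⟨u, rfl⟩ : ∃ u, a = u + 3 := ⟨a - 3, by
    have : a - 2 ≠ 0 := by rintro h; simp [h] at h3
    omega⟩
  obtain ⟨v, rfl⟩ : ∃ v, b = v + 3 := ⟨b - 3, by
    have : b - 2 ≠ 0 := by rintro h; simp [h] at h3
    omega⟩
  obtain ⟨w, rfl⟩ : ∃ w, c = w + 3 := ⟨c - 3, by
    have : c - 2 ≠ 0 := by rintro h; simp [h] at h1
    omega⟩
  simp only [show ∀ n, n + 3 - 2 = n + 1 by omega, show ∀ n, n + 3 - 1 = n + 2 by omega] at *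
  refine ⟨?_, ?_, ?_⟩ <;> by_contra! hlt
  · obtain ⟨t, rfl⟩ : ∃ t, u = t + 27 := ⟨u - 27, by omega⟩
    nlinarith [Nat.zero_le (v * w), Nat.zero_le (t * v), Nat.zero_le (t * w)]
  · obtain ⟨t, rfl⟩ : ∃ t, v = t + 21 := ⟨v - 21, by omega⟩
    nlinarith [Nat.zero_le (u * w), Nat.zero_le (t * u), Nat.zero_le (t * w)]
  · obtain ⟨t, rfl⟩ : ∃ t, w = t + 27 := ⟨w - 27, by omega⟩
    nlinarith [Nat.zero_le (u * v), Nat.zero_le (t * u), Nat.zero_le (t * v)]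

theorem two_lt_mul_of {x y : ℕ} (hx : 3 ≤ x) (hy : 3 ≤ y) (h33 : ¬ (x = 3 ∧ y = 3))
    (h34 : ¬ (x = 3 ∧ y = 4)) (h43 : ¬ (x = 4 ∧ y = 3)) : 2 < (x - 2) * (y - 2) := by
  obtain ⟨u, rfl⟩ := Nat.exists_eq_add_of_le hx
  obtain ⟨v, rfl⟩ := Nat.exists_eq_add_of_le hy
  simp only [show ∀ n, 3 + n - 2 = n + 1 by omega]
  rcases Nat.lt_or_ge u 2 with hu | hu
  · interval_cases u <;> omega
  · nlinarith [Nat.zero_le (u * v)]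

theorem four_lt_mul_of {x y : ℕ} (hx : 3 ≤ x) (hy : 3 ≤ y) (h33 : ¬ (x = 3 ∧ y = 3))
    (h34 : ¬ (x = 3 ∧ y = 4)) (h43 : ¬ (x = 4 ∧ y = 3)) (h35 : ¬ (x = 3 ∧ y = 5))
    (h36 : ¬ (x = 3 ∧ y = 6)) (h44 : ¬ (x = 4 ∧ y = 4)) (h53 : ¬ (x = 5 ∧ y = 3))
    (h63 : ¬ (x = 6 ∧ y = 3)) : 4 < (x - 2) * (y - 2) := by
  obtain ⟨u, rfl⟩ := Nat.exists_eq_add_of_le hx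
  obtain ⟨v, rfl⟩ := Nat.exists_eq_add_of_le hy
  simp only [show ∀ n, 3 + n - 2 = n + 1 by omega]
  rcases Nat.lt_or_ge u 4 with hu | hu
  · interval_cases u <;> omega
  · nlinarith [Nat.zero_le (u * v)]

theorem sporadic_of_S31 {m : Fin 3 → ℕ} {q : Fin 3 → ℚ} (h : IsIrreducibleExponent S31 m q)
    (hm : m ∉ infiniteExponents31) : chargesOf q ∈ sporadicCharges := by
  have hq := eq_of_isFeasible_S31 h.1
  have ha := h.1.pointer_exponent 0 1 rfl
  have hb := h.1.pointer_exponent 1 2 rfl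
  have hc := h.1.root_exponent 2 rfl
  have hd : 0 < m 0 * m 1 * m 2 := by positivity
  rw [hq, isIrreducibleExponent_S31_div_iff hd] at h
  obtain ⟨-, ⟨hx, hy⟩, hs⟩ := h
  simp only [infiniteExponents31, Set.mem_ofPred_eq, not_or] at hm
  obtain ⟨n1, n2, n3, n4, n5, n6, n7, n8, n9, n10, n11, n12, n13, n14, n15, n16⟩ := hm
  have ha' : 3 ≤ m 0 := lt_of_le_of_ne ha (Ne.symm n1)
  have hb' : 3 ≤ m 1 := lt_of_le_of_ne hb (Ne.symm n2)
  have h1 := two_lt_mul_of hb' hc n5 n8 n11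
  have h2 := four_lt_mul_of ha' hc n4 n7 n10 n12 n13 n14 n15 n16
  have h3 := two_lt_mul_of ha' hb' n3 n6 n9
  obtain ⟨ba, bb, bc⟩ := bounds_S31 h1 h2 h3 hs
  have key := allBelow_apply sporadicTest_of_candidate31 ba bb bc
  have hcand : Candidate31 (m 0) (m 1) (m 2) := ⟨h1, h2, h3, hs, hx, hy⟩
  simp only [hcand, decide_true, Bool.not_true, Bool.false_or] at key
  rw [hq]
  exact mem_sporadicCharges_of_test hd key

theorem charges31_of_infinite {m : Fin 3 → ℕ} {q : Fin 3 → ℚ} (h : IsIrreducibleExponent S31 m q)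
    (hm : m ∈ infiniteExponents31) : chargesOf q ∈ charges31 := by
  have ha := h.1.pointer_exponent 0 1 rfl
  have hb := h.1.pointer_exponent 1 2 rfl
  have hc := h.1.root_exponent 2 rfl
  have e0 := h.1.pointer_charge 0 1 rfl
  have e1 := h.1.pointer_charge 1 2 rfl
  have e2 := h.1.root_charge 2 rfl
  have i1 := h.2.1.2 1 (by simp [S31])
  rw [chargesOf_three]
  have ha0 : (m 0 : ℚ) ≠ 0 := by norm_cast; omega
  have hb0 : (m 1 : ℚ) ≠ 0 := by norm_cast; omega
  have hc0 : (m 2 : ℚ) ≠ 0 := by norm_cast; omega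
  -- The charges are solved from the root upwards along the chain.
  have f2 : q 2 = 1 / m 2 := by rw [eq_div_iff hc0, mul_comm, e2]
  have f1 : q 1 = (1 - q 2) / m 1 := by rw [eq_div_iff hb0]; linear_combination e1
  have f0 : q 0 = (1 - q 1) / m 0 := by rw [eq_div_iff ha0]; linear_combination e0
  rw [f2] at f1
  rw [f1] at f0 i1
  rw [f0, f1, f2]
  clear e0 e1 e2 f0 f1 f2
  simp only [infiniteExponents31, Set.mem_ofPred_eq] at hm
  generalize m 0 = a, m 1 = b, m 2 = c at *
  have hc1 : (c : ℚ) - 1 ≠ 0 := by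
    rw [sub_ne_zero]
    norm_cast
    omega
  rcases hm with rfl | rfl | ⟨rfl, rfl⟩ | ⟨rfl, rfl⟩ | ⟨rfl, rfl⟩ | ⟨rfl, rfl⟩ | ⟨rfl, rfl⟩ |
    ⟨rfl, rfl⟩ | ⟨rfl, rfl⟩ | ⟨rfl, rfl⟩ | ⟨rfl, rfl⟩ | ⟨rfl, rfl⟩ | ⟨rfl, rfl⟩ | ⟨rfl, rfl⟩ |
    ⟨rfl, rfl⟩ | ⟨rfl, rfl⟩
  · refine Or.inr (Or.inr ⟨b, c, hb, hc, Or.inr (triple_congr ?_ ?_ ?_)⟩) <;> field_simp <;> ring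
  · refine Or.inr (Or.inr ⟨a, c, ha, hc, Or.inl (triple_congr ?_ ?_ ?_)⟩) <;> field_simp <;> ring
  · refine Or.inr (Or.inl ⟨c, hc, Or.inl (triple_congr ?_ ?_ ?_)⟩) <;>
      push_cast <;> field_simp <;> ring
  · refine Or.inl ⟨b, hb, Or.inr (Or.inl (triple_congr ?_ ?_ ?_))⟩ <;>
      push_cast <;> field_simp <;> ring
  · refine Or.inl ⟨a, ha, Or.inl (triple_congr ?_ ?_ ?_)⟩ <;>
      push_cast <;> field_simp <;> ring
  · refine Or.inr (Or.inl ⟨c, hc, Or.inr (Or.inr (triple_congr ?_ ?_ ?_))⟩) <;>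
      push_cast <;> field_simp <;> ring
  · refine Or.inl ⟨b, hb, Or.inr (Or.inr (Or.inr (Or.inr (Or.inr (Or.inl
      (triple_congr ?_ ?_ ?_))))))⟩ <;> push_cast <;> field_simp <;> ring
  -- For `(m 1, m 2) = (3, 4)` the middle charge is `1 / 4`, so the middle pointer could be a root
  -- and the graph is reducible. The same happens below for `(4, 3)`, where it is `1 / 6`. Hence
  -- these two families of exponents contribute no family of charges.
  · exact absurd (by norm_num) (i1 4)
  · refine Or.inr (Or.inl ⟨c, hc, Or.inr (Or.inl (triple_congr ?_ ?_ ?_))⟩) <;>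
      push_cast <;> field_simp <;> ring
  · refine Or.inl ⟨b, hb, Or.inr (Or.inr (Or.inl (triple_congr ?_ ?_ ?_)))⟩ <;>
      push_cast <;> field_simp <;> ring
  · exact absurd (by norm_num) (i1 6)
  · refine Or.inl ⟨b, hb, Or.inr (Or.inr (Or.inr (Or.inr (Or.inr (Or.inr (Or.inr (Or.inl
      (triple_congr ?_ ?_ ?_))))))))⟩ <;> push_cast <;> field_simp <;> ring
  · refine Or.inl ⟨b, hb, Or.inr (Or.inr (Or.inr (Or.inr (Or.inr (Or.inr (Or.inr (Or.inr
      (triple_congr ?_ ?_ ?_))))))))⟩ <;> push_cast <;> field_simp <;> ring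
  · refine Or.inl ⟨b, hb, Or.inr (Or.inr (Or.inr (Or.inr (Or.inr (Or.inr (Or.inl
      (triple_congr ?_ ?_ ?_)))))))⟩ <;> push_cast <;> field_simp <;> ring
  · refine Or.inl ⟨b, hb, Or.inr (Or.inr (Or.inr (Or.inl (triple_congr ?_ ?_ ?_))))⟩ <;>
      push_cast <;> field_simp <;> ring
  · refine Or.inl ⟨b, hb, Or.inr (Or.inr (Or.inr (Or.inr (Or.inl (triple_congr ?_ ?_ ?_)))))⟩ <;>
      push_cast <;> field_simp <;> ring

theorem mem_feasibleCharges_S31 {a b c : ℕ} (ha : 2 ≤ a) (hb : 2 ≤ b) (hc : 3 ≤ c)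
    (h : a * b * c < 2 * ((b - 1) * c + 1 + a * (c - 1) + a * b)) {x y z : ℚ}
    (e0 : (a : ℚ) * x + y = 1) (e1 : (b : ℚ) * y + z = 1) (e2 : (c : ℚ) * z = 1) :
    ({x, y, z} : Multiset ℚ) ∈ feasibleCharges S31 := by
  have hf : IsFeasible S31 ![a, b, c] ![x, y, z] := by
    constructor <;> simp [Fin.forall_fin_succ, S31, *]
  refine ⟨![a, b, c], ![x, y, z], hf, ?_, rfl⟩
  have := eq_of_isFeasible_S31 hf
  have hd : 0 < a * b * c := by positivity
  rw [this, vec_div_eq]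
  exact (centralCharge_div_lt_six_iff hd).2 h

theorem charges31_subset : charges31 ⊆ feasibleCharges S31 := by
  rintro Q (⟨k, hk, h⟩ | ⟨k, hk, h⟩ | ⟨k, l, hk, hl, h⟩)
  · have hk0 : (k : ℚ) ≠ 0 := by norm_cast; omega
    rcases h with rfl | rfl | rfl | rfl | rfl | rfl | rfl | rfl | rfl
    · refine mem_feasibleCharges_S31 (a := k) (b := 3) (c := 3) ?_ ?_ ?_ ?_ ?_ ?_ ?_ <;>
        first | omega | (push_cast; field_simp; try ring)
    · refine mem_feasibleCharges_S31 (a := 3) (b := k) (c := 3) ?_ ?_ ?_ ?_ ?_ ?_ ?_ <;>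
        first | omega | (push_cast; field_simp; try ring)
    · refine mem_feasibleCharges_S31 (a := 4) (b := k) (c := 3) ?_ ?_ ?_ ?_ ?_ ?_ ?_ <;>
        first | omega | (push_cast; field_simp; try ring)
    · refine mem_feasibleCharges_S31 (a := 5) (b := k) (c := 3) ?_ ?_ ?_ ?_ ?_ ?_ ?_ <;>
        first | omega | (push_cast; field_simp; try ring)
    · refine mem_feasibleCharges_S31 (a := 6) (b := k) (c := 3) ?_ ?_ ?_ ?_ ?_ ?_ ?_ <;>
        first | omega | (push_cast; field_simp; try ring)
    · refine mem_feasibleCharges_S31 (a := 3) (b := k) (c := 4) ?_ ?_ ?_ ?_ ?_ ?_ ?_ <;>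
        first | omega | (push_cast; field_simp; try ring)
    · refine mem_feasibleCharges_S31 (a := 4) (b := k) (c := 4) ?_ ?_ ?_ ?_ ?_ ?_ ?_ <;>
        first | omega | (push_cast; field_simp; try ring)
    · refine mem_feasibleCharges_S31 (a := 3) (b := k) (c := 5) ?_ ?_ ?_ ?_ ?_ ?_ ?_ <;>
        first | omega | (push_cast; field_simp; try ring)
    · refine mem_feasibleCharges_S31 (a := 3) (b := k) (c := 6) ?_ ?_ ?_ ?_ ?_ ?_ ?_ <;>
        first | omega | (push_cast; field_simp; try ring)
  · have hk0 : (k : ℚ) ≠ 0 := by norm_cast; omega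
    rcases h with rfl | rfl | rfl
    · refine mem_feasibleCharges_S31 (a := 3) (b := 3) (c := k) ?_ ?_ ?_ ?_ ?_ ?_ ?_ <;>
        first | omega | (push_cast; field_simp; try ring)
    · refine mem_feasibleCharges_S31 (a := 4) (b := 3) (c := k) ?_ ?_ ?_ ?_ ?_ ?_ ?_ <;>
        first | omega | (push_cast; field_simp; try ring)
    · refine mem_feasibleCharges_S31 (a := 3) (b := 4) (c := k) ?_ ?_ ?_ ?_ ?_ ?_ ?_ <;>
        first | omega | (push_cast; field_simp; try ring)
  · have hk0 : (k : ℚ) ≠ 0 := by norm_cast; omega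
    have hl0 : (l : ℚ) ≠ 0 := by norm_cast; omega
    have h1 : k * 2 * l < 2 * ((2 - 1) * l + 1 + k * (l - 1) + k * 2) := by
      obtain ⟨l, rfl⟩ := Nat.exists_eq_add_of_le hl
      simp only [show ∀ n, 3 + n - 1 = n + 2 by omega]
      nlinarith
    have h2 : 2 * k * l < 2 * ((k - 1) * l + 1 + 2 * (l - 1) + 2 * k) := by
      obtain ⟨l, rfl⟩ := Nat.exists_eq_add_of_le hl
      obtain ⟨k, rfl⟩ := Nat.exists_eq_add_of_le hk
      simp only [show ∀ n, 3 + n - 1 = n + 2 by omega, show ∀ n, 2 + n - 1 = n + 1 by omega]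
      nlinarith
    rcases h with rfl | rfl
    · refine mem_feasibleCharges_S31 (a := k) (b := 2) (c := l) hk le_rfl hl h1 ?_ ?_ ?_ <;>
        (push_cast; field_simp; try ring)
    · refine mem_feasibleCharges_S31 (a := 2) (b := k) (c := l) le_rfl hk hl h2 ?_ ?_ ?_ <;>
        (push_cast; field_simp; try ring)

/-! The cyclic graph `X₁ → X₂ → X₃ → X₁`. -/

/-- The numerators belong to irreducible exponents on `S33` outside the infinite families. -/
def Candidate33 (a b c : ℕ) : Prop :=
  2 < (a - 2) * (b - 2) ∧ 2 < (b - 2) * (c - 2) ∧ 2 < (c - 2) * (a - 2) ∧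
    a * b * c + 1 < 2 * ((b - 1) * c + 1 + ((c - 1) * a + 1) + ((a - 1) * b + 1)) ∧
    ¬ (b - 1) * c + 1 ∣ a * b * c + 1 ∧ ¬ (c - 1) * a + 1 ∣ a * b * c + 1 ∧
    ¬ (a - 1) * b + 1 ∣ a * b * c + 1

instance (a b c : ℕ) : Decidable (Candidate33 a b c) := by
  unfold Candidate33
  infer_instance

theorem sporadicTest_of_candidate33 : allBelow 19 19 19 (fun a b c =>
    !decide (Candidate33 a b c) ||
      sporadicTest ((b - 1) * c + 1) ((c - 1) * a + 1) ((a - 1) * b + 1) (a * b * c + 1)) =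
        true := by
  decide +kernel

theorem eq_of_isFeasible_S33 {m : Fin 3 → ℕ} {q : Fin 3 → ℚ} (h : IsFeasible S33 m q) :
    q = ![(((m 1 - 1) * m 2 + 1 : ℕ) : ℚ) / (m 0 * m 1 * m 2 + 1 : ℕ),
      (((m 2 - 1) * m 0 + 1 : ℕ) : ℚ) / (m 0 * m 1 * m 2 + 1 : ℕ),
      (((m 0 - 1) * m 1 + 1 : ℕ) : ℚ) / (m 0 * m 1 * m 2 + 1 : ℕ)] := by
  have ha := h.pointer_exponent 0 1 rfl
  have hb := h.pointer_exponent 1 2 rfl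
  have hc := h.pointer_exponent 2 0 rfl
  have e0 := h.pointer_charge 0 1 rfl
  have e1 := h.pointer_charge 1 2 rfl
  have e2 := h.pointer_charge 2 0 rfl
  obtain ⟨a, ha'⟩ : ∃ a, m 0 = a + 1 := ⟨m 0 - 1, by omega⟩
  obtain ⟨b, hb'⟩ : ∃ b, m 1 = b + 1 := ⟨m 1 - 1, by omega⟩
  obtain ⟨c, hc'⟩ : ∃ c, m 2 = c + 1 := ⟨m 2 - 1, by omega⟩
  rw [ha'] at e0 ⊢
  rw [hb'] at e1 ⊢
  rw [hc'] at e2 ⊢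
  push_cast at *
  ext i
  fin_cases i <;> simp <;> rw [eq_div_iff (by positivity)]
  · linear_combination (b + 1 : ℚ) * (c + 1) * e0 - (c + 1 : ℚ) * e1 + e2
  · linear_combination (c + 1 : ℚ) * (a + 1) * e1 - (a + 1 : ℚ) * e2 + e0
  · linear_combination (a + 1 : ℚ) * (b + 1) * e2 - (b + 1 : ℚ) * e0 + e1

/-- As for the chain, `a` has the positive coefficient `(b - 2) * (c - 2) - 2`; the worst case `{b,
c} = {3, 5}` gives `19`. The hypotheses are invariant under rotation, so the same lemma bounds `b`
and `c`. -/
theorem bound_S33 {a b c : ℕ} (h1 : 2 < (a - 2) * (b - 2)) (h2 : 2 < (b - 2) * (c - 2))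
    (h3 : 2 < (c - 2) * (a - 2))
    (h : a * b * c + 1 < 2 * ((b - 1) * c + 1 + ((c - 1) * a + 1) + ((a - 1) * b + 1))) :
    a < 19 := by
  obtain ⟨u, rfl⟩ : ∃ u, a = u + 3 := ⟨a - 3, by
    have : a - 2 ≠ 0 := by rintro h; simp [h] at h3
    omega⟩
  obtain ⟨v, rfl⟩ : ∃ v, b = v + 3 := ⟨b - 3, by
    have : b - 2 ≠ 0 := by rintro h; simp [h] at h1
    omega⟩
  obtain ⟨w, rfl⟩ : ∃ w, c = w + 3 := ⟨c - 3, by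
    have : c - 2 ≠ 0 := by rintro h; simp [h] at h2
    omega⟩
  simp only [show ∀ n, n + 3 - 2 = n + 1 by omega, show ∀ n, n + 3 - 1 = n + 2 by omega] at *
  by_contra! hlt
  obtain ⟨t, rfl⟩ : ∃ t, u = t + 16 := ⟨u - 16, by omega⟩
  nlinarith [Nat.zero_le (v * w), Nat.zero_le (t * v), Nat.zero_le (t * w)]

theorem sporadic_of_S33 {m : Fin 3 → ℕ} {q : Fin 3 → ℚ} (h : IsIrreducibleExponent S33 m q)
    (hm : m ∉ infiniteExponents33) : chargesOf q ∈ sporadicCharges := by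
  have hq := eq_of_isFeasible_S33 h.1
  have ha := h.1.pointer_exponent 0 1 rfl
  have hb := h.1.pointer_exponent 1 2 rfl
  have hc := h.1.pointer_exponent 2 0 rfl
  have hd : 0 < m 0 * m 1 * m 2 + 1 := by positivity
  rw [hq, isIrreducibleExponent_S33_div_iff hd] at h
  obtain ⟨-, ⟨hx, hy, hz⟩, hs⟩ := h
  simp only [infiniteExponents33, Set.mem_ofPred_eq, not_exists, not_or] at hm
  have three_le : ∀ i, 2 ≤ m i → 3 ≤ m i := fun i hi => lt_of_le_of_ne hi (Ne.symm (hm i).1)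
  have key : ∀ i, 2 ≤ m i → 2 ≤ m (i + 1) → 2 < (m i - 2) * (m (i + 1) - 2) := fun i hi hi' =>
    two_lt_mul_of (three_le i hi) (three_le _ hi') (hm i).2.1 (hm i).2.2.1 (hm i).2.2.2
  have h1 := key 0 ha hb
  have h2 := key 1 hb hc
  have h3 := key 2 hc ha
  simp only [Fin.isValue, zero_add, Fin.reduceAdd] at h1 h2 h3
  have ba := bound_S33 h1 h2 h3 hs
  have bb := bound_S33 h2 h3 h1 (by linarith)
  have bc := bound_S33 h3 h1 h2 (by linarith)
  have key := allBelow_apply sporadicTest_of_candidate33 ba bb bc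
  have hcand : Candidate33 (m 0) (m 1) (m 2) := ⟨h1, h2, h3, hs, hx, hy, hz⟩
  simp only [hcand, decide_true, Bool.not_true, Bool.false_or] at key
  rw [hq]
  exact mem_sporadicCharges_of_test hd key

/-- Handles the infinite families when the special exponents start at the first node; the other
positions follow by rotating the cycle. The combinations used solve the cyclic linear system, whose
determinant is `a * b * c + 1`. -/
theorem charges33_of_cycle {a b c : ℕ} (ha : 2 ≤ a) (hb : 2 ≤ b) (hc : 2 ≤ c) {x y z : ℚ}
    (e0 : (a : ℚ) * x + y = 1) (e1 : (b : ℚ) * y + z = 1) (e2 : (c : ℚ) * z + x = 1)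
    (h : a = 2 ∨ (a = 3 ∧ b = 3) ∨ (a = 3 ∧ b = 4) ∨ (a = 4 ∧ b = 3)) :
    ({x, y, z} : Multiset ℚ) ∈ charges33 := by
  rcases h with rfl | ⟨rfl, rfl⟩ | ⟨rfl, rfl⟩ | ⟨rfl, rfl⟩ <;> push_cast at *
  · refine Or.inr ⟨b, c, hb, hc, triple_congr ?_ ?_ ?_⟩ <;> rw [eq_div_iff (by positivity)]
    · linear_combination (b : ℚ) * c * e0 - (c : ℚ) * e1 + e2
    · linear_combination (c : ℚ) * 2 * e1 - 2 * e2 + e0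
    · linear_combination 2 * (b : ℚ) * e2 - (b : ℚ) * e0 + e1
  · refine Or.inl ⟨c, hc, Or.inl (triple_congr ?_ ?_ ?_)⟩ <;> rw [eq_div_iff (by positivity)]
    · linear_combination 3 * (c : ℚ) * e0 - (c : ℚ) * e1 + e2
    · linear_combination (c : ℚ) * 3 * e1 - 3 * e2 + e0
    · linear_combination 9 * e2 - 3 * e0 + e1
  · refine Or.inl ⟨c, hc, Or.inr (Or.inr (triple_congr ?_ ?_ ?_))⟩ <;>
      rw [eq_div_iff (by positivity)]
    · linear_combination 4 * (c : ℚ) * e0 - (c : ℚ) * e1 + e2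
    · linear_combination (c : ℚ) * 3 * e1 - 3 * e2 + e0
    · linear_combination 12 * e2 - 4 * e0 + e1
  · refine Or.inl ⟨c, hc, Or.inr (Or.inl (triple_congr ?_ ?_ ?_))⟩ <;>
      rw [eq_div_iff (by positivity)]
    · linear_combination 3 * (c : ℚ) * e0 - (c : ℚ) * e1 + e2
    · linear_combination (c : ℚ) * 4 * e1 - 4 * e2 + e0
    · linear_combination 12 * e2 - 3 * e0 + e1

theorem charges33_of_infinite {m : Fin 3 → ℕ} {q : Fin 3 → ℚ} (h : IsIrreducibleExponent S33 m q)
    (hm : m ∈ infiniteExponents33) : chargesOf q ∈ charges33 := by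
  have ha := h.1.pointer_exponent 0 1 rfl
  have hb := h.1.pointer_exponent 1 2 rfl
  have hc := h.1.pointer_exponent 2 0 rfl
  have e0 := h.1.pointer_charge 0 1 rfl
  have e1 := h.1.pointer_charge 1 2 rfl
  have e2 := h.1.pointer_charge 2 0 rfl
  rw [chargesOf_three]
  obtain ⟨i, hi⟩ := hm
  fin_cases i
  · exact charges33_of_cycle ha hb hc e0 e1 e2 hi
  · rw [multiset_rotate]
    exact charges33_of_cycle hb hc ha e1 e2 e0 hi
  · rw [multiset_rotate, multiset_rotate]
    exact charges33_of_cycle hc ha hb e2 e0 e1 hi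

theorem mem_feasibleCharges_S33 {a b c : ℕ} (ha : 2 ≤ a) (hb : 2 ≤ b) (hc : 2 ≤ c)
    (h : a * b * c + 1 < 2 * ((b - 1) * c + 1 + ((c - 1) * a + 1) + ((a - 1) * b + 1))) {x y z : ℚ}
    (e0 : (a : ℚ) * x + y = 1) (e1 : (b : ℚ) * y + z = 1) (e2 : (c : ℚ) * z + x = 1) :
    ({x, y, z} : Multiset ℚ) ∈ feasibleCharges S33 := by
  have hf : IsFeasible S33 ![a, b, c] ![x, y, z] := by
    constructor <;> simp [Fin.forall_fin_succ, S33, *]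
  refine ⟨![a, b, c], ![x, y, z], hf, ?_, rfl⟩
  have := eq_of_isFeasible_S33 hf
  have hd : 0 < a * b * c + 1 := by positivity
  rw [this, vec_div_eq]
  exact (centralCharge_div_lt_six_iff hd).2 h

theorem charges33_subset : charges33 ⊆ feasibleCharges S33 := by
  rintro Q (⟨k, hk, h⟩ | ⟨k, l, hk, hl, h⟩)
  · have h1 : (9 * k + 1 : ℚ) ≠ 0 := by positivity
    have h2 : (12 * k + 1 : ℚ) ≠ 0 := by positivity
    rcases h with rfl | rfl | rfl
    · refine mem_feasibleCharges_S33 (a := 3) (b := 3) (c := k) ?_ ?_ ?_ ?_ ?_ ?_ ?_ <;>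
        first | omega | (push_cast; field_simp; ring)
    · refine mem_feasibleCharges_S33 (a := 4) (b := 3) (c := k) ?_ ?_ ?_ ?_ ?_ ?_ ?_ <;>
        first | omega | (push_cast; field_simp; ring)
    · refine mem_feasibleCharges_S33 (a := 3) (b := 4) (c := k) ?_ ?_ ?_ ?_ ?_ ?_ ?_ <;>
        first | omega | (push_cast; field_simp; ring)
  · have h1 : (2 * k * l + 1 : ℚ) ≠ 0 := by positivity
    have h2 : 2 * k * l + 1 < 2 * ((k - 1) * l + 1 + ((l - 1) * 2 + 1) + ((2 - 1) * k + 1)) := by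
      obtain ⟨l, rfl⟩ := Nat.exists_eq_add_of_le hl
      obtain ⟨k, rfl⟩ := Nat.exists_eq_add_of_le hk
      simp only [show ∀ n, 2 + n - 1 = n + 1 by omega]
      nlinarith
    subst h
    refine mem_feasibleCharges_S33 (a := 2) (b := k) (c := l) le_rfl hk hl h2 ?_ ?_ ?_ <;>
      (push_cast; field_simp; ring)

/-! The star `X₁ → X₂ ← X₃` with root `X₂`. -/

/-- Some monomial in two variables with charges `x / d` and `z / d` has charge one. -/
def linkTest (x z d : ℕ) : Bool :=
  (List.range (d / z + 1)).any fun b => decide (x ∣ d - b * z)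

theorem linkTest_of_exists {x z d : ℕ} (hz : 0 < z) (h : ∃ a b : ℕ, a * x + b * z = d) :
    linkTest x z d = true := by
  obtain ⟨a, b, h⟩ := h
  simp only [linkTest, List.any_eq_true, List.mem_range, decide_eq_true_eq]
  refine ⟨b, ?_, a, ?_⟩
  · rw [Nat.lt_succ_iff, Nat.le_div_iff_mul_le hz]
    omega
  · rw [← h, Nat.add_sub_cancel, mul_comm]

theorem eq_of_isFeasible_S32 {m : Fin 3 → ℕ} {q : Fin 3 → ℚ} (h : IsFeasible S32 m q) :
    q = ![(((m 1 - 1) * m 2 : ℕ) : ℚ) / (m 0 * m 1 * m 2 : ℕ),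
      ((m 0 * m 2 : ℕ) : ℚ) / (m 0 * m 1 * m 2 : ℕ),
      (((m 1 - 1) * m 0 : ℕ) : ℚ) / (m 0 * m 1 * m 2 : ℕ)] := by
  have ha := h.pointer_exponent 0 1 rfl
  have hb := h.root_exponent 1 rfl
  have hc := h.pointer_exponent 2 1 rfl
  have e0 := h.pointer_charge 0 1 rfl
  have e1 := h.root_charge 1 rfl
  have e2 := h.pointer_charge 2 1 rfl
  obtain ⟨b, hb'⟩ : ∃ b, m 1 = b + 1 := ⟨m 1 - 1, by omega⟩
  rw [hb'] at e1 ⊢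
  have ha0 : (m 0 : ℚ) ≠ 0 := by norm_cast; omega
  have hc0 : (m 2 : ℚ) ≠ 0 := by norm_cast; omega
  push_cast at *
  have hb0 : (b : ℚ) + 1 ≠ 0 := by positivity
  ext i
  fin_cases i <;> simp <;> rw [eq_div_iff (by positivity)]
  · linear_combination (b + 1 : ℚ) * m 2 * e0 - (m 2 : ℚ) * e1
  · linear_combination (m 0 : ℚ) * m 2 * e1
  · linear_combination (b + 1 : ℚ) * m 0 * e2 - (m 0 : ℚ) * e1

/-- The numerical conditions for irreducible exponents `a, e + 1, c` on `S32`. -/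
structure IrreducibleNumerics32 (a e c : ℕ) : Prop where
  two_le_left : 2 ≤ a
  two_le_right : 2 ≤ c
  two_le : 2 ≤ e
  not_dvd_left : ¬ e ∣ a
  not_dvd_right : ¬ e ∣ c
  link : ∃ α β : ℕ, α * (e * c) + β * (e * a) = a * (e + 1) * c
  charge : a * (e + 1) * c < 2 * (e * c + a * c + e * a)

theorem IsIrreducibleExponent.numerics32 {m : Fin 3 → ℕ} {q : Fin 3 → ℚ}
    (h : IsIrreducibleExponent S32 m q) : IrreducibleNumerics32 (m 0) (m 1 - 1) (m 2) := by
  have hq := eq_of_isFeasible_S32 h.1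
  have ha := h.1.pointer_exponent 0 1 rfl
  have hb := h.1.root_exponent 1 rfl
  have hc := h.1.pointer_exponent 2 1 rfl
  have hd : 0 < m 0 * m 1 * m 2 := by positivity
  rw [hq, isIrreducibleExponent_S32_div_iff hd] at h
  obtain ⟨⟨-, -, -, hl⟩, ⟨hx, hz⟩, hs⟩ := h
  obtain ⟨e, he⟩ : ∃ e, m 1 = e + 1 := ⟨m 1 - 1, by omega⟩
  rw [he] at hl hx hz hs ⊢
  simp only [Nat.add_sub_cancel] at hl hx hz hs ⊢
  refine ⟨ha, hc, by omega, fun h => hx ?_, fun h => hz ?_, hl, hs⟩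
  · obtain ⟨k, hk⟩ := h
    exact ⟨k * (e + 1), by rw [hk]; ring⟩
  · obtain ⟨k, hk⟩ := h
    exact ⟨k * (e + 1), by rw [hk]; ring⟩

/-- Both terms of the link equation are multiples of `e`, and `a * (e + 1) * c` is congruent to `a *
c` modulo `e`. -/
theorem IrreducibleNumerics32.dvd_mul {a e c : ℕ} (h : IrreducibleNumerics32 a e c) :
    e ∣ a * c := by
  obtain ⟨α, β, h⟩ := h.link
  have h1 : e ∣ a * (e + 1) * c := ⟨α * c + β * a, by rw [← h]; ring⟩
  rw [show a * (e + 1) * c = e * (a * c) + a * c by ring] at h1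
  exact (Nat.dvd_add_right (Dvd.intro _ rfl)).1 h1

/-- From `e ∣ 2 * c` and `e ∤ c` it follows that `e = 2 * f` and `c = f * g` with `g` odd. Dividing
the link equation by `2 * f` then leaves an odd right side, which forces `f` to be odd; `f = 1` is
excluded by `e ∤ 2`. -/
theorem IrreducibleNumerics32.of_two {e c : ℕ} (h : IrreducibleNumerics32 2 e c) :
    ∃ s t : ℕ, 1 ≤ t ∧ e + 1 = 4 * t + 3 ∧ c = (2 * s + 1) * (2 * t + 1) := by
  have hdvd := h.dvd_mul
  have h2 : 2 ∣ e := by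
    by_contra h2
    exact h.not_dvd_right
      (((Nat.prime_two.coprime_iff_not_dvd.2 h2).symm).dvd_of_dvd_mul_left hdvd)
  obtain ⟨f, rfl⟩ := h2
  obtain ⟨g, rfl⟩ := Nat.dvd_of_mul_dvd_mul_left two_pos hdvd
  have hf : 0 < f := by have := h.two_le; omega
  have hg : g % 2 = 1 := by
    by_contra hg
    obtain ⟨g', rfl⟩ : ∃ g', g = 2 * g' := ⟨g / 2, by omega⟩
    exact h.not_dvd_right ⟨g', by ring⟩
  obtain ⟨α, β, hl⟩ := h.link
  have hl : α * f * g + 2 * β = 2 * (f * g) + g := by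
    have : 0 < 2 * f := by omega
    apply Nat.eq_of_mul_eq_mul_left this
    linarith
  have hodd : f % 2 = 1 := by
    by_contra hf2
    obtain ⟨f', rfl⟩ : ∃ f', f = 2 * f' := ⟨f / 2, by omega⟩
    rw [show α * (2 * f') * g = 2 * (α * f' * g) by ring] at hl
    omega
  refine ⟨g / 2, f / 2, ?_, by omega, ?_⟩
  · by_contra hf1
    exact h.not_dvd_left (by rw [show f = 1 by omega])
  · rw [mul_comm]
    congr 1 <;> omega

/-- The irreducible exponents on `S32` outside the infinite family, up to symmetry. -/
def exceptionalExponents32 : List (ℕ × ℕ × ℕ) :=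
  [(3, 7, 4), (3, 7, 8), (3, 7, 10), (3, 13, 4), (3, 16, 5)]

theorem exceptional32_of_candidate : allBelow 6 24 121 (fun a c e =>
    !decide (3 ≤ a ∧ a ≤ c ∧ 4 ≤ e ∧ e ∣ a * c ∧ ¬ e ∣ a ∧ ¬ e ∣ c ∧
      a * (e + 1) * c < 2 * (e * c + a * c + e * a) ∧
      linkTest (e * c) (e * a) (a * (e + 1) * c) = true) ||
    decide ((a, e + 1, c) ∈ exceptionalExponents32)) = true := by
  decide +kernel

theorem IrreducibleNumerics32.of_three_le {a e c : ℕ} (h : IrreducibleNumerics32 a e c)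
    (ha : 3 ≤ a) (hac : a ≤ c) : (a, e + 1, c) ∈ exceptionalExponents32 := by
  have hdvd := h.dvd_mul
  -- A prime dividing `a * c` would divide one of the factors; so `e` is not prime, and in
  -- particular `e ≥ 4`.
  have hprime : ∀ p, p.Prime → e ≠ p := by
    rintro p hp rfl
    exact (hp.dvd_mul.1 hdvd).elim h.not_dvd_left h.not_dvd_right
  have h2 := hprime 2 Nat.prime_two
  have h3 := hprime 3 Nat.prime_three
  have he : 4 ≤ e := by have := h.two_le; omega
  have hch := h.charge
  -- The charge inequality says that `e * (a * c - 2 * a - 2 * c) < a * c` over the integers. With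
  -- `e ≥ 4` this bounds `a * c` by a multiple of `a + c`, and hence bounds `a` and then `c`; the
  -- extreme case is `a = 3`, `c < 24`.
  have hac' : 3 * (a * c) < 8 * (a + c) := by
    by_contra! hcon
    nlinarith [Nat.mul_le_mul he (le_refl (a * c))]
  have ha6 : a < 6 := by
    by_contra! hcon
    nlinarith
  have hc24 : c < 24 := by
    interval_cases a <;> omega
  have he121 : e < 121 := by
    -- The divisibility `e ∣ a * c` now bounds `e` as well.
    refine lt_of_le_of_lt (Nat.le_of_dvd (Nat.mul_pos (by omega) (by omega)) hdvd) ?_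
    have : a * c ≤ 5 * 23 := Nat.mul_le_mul (by omega) (by omega)
    omega
  have key := allBelow_apply exceptional32_of_candidate ha6 hc24 he121
  have hc : 3 ≤ a ∧ a ≤ c ∧ 4 ≤ e ∧ e ∣ a * c ∧ ¬ e ∣ a ∧ ¬ e ∣ c ∧
      a * (e + 1) * c < 2 * (e * c + a * c + e * a) ∧
      linkTest (e * c) (e * a) (a * (e + 1) * c) = true :=
    ⟨ha, hac, he, hdvd, h.not_dvd_left, h.not_dvd_right, hch,
      linkTest_of_exists (by positivity) h.link⟩
  simpa [hc] using key

theorem vec_three_eq_iff {m : Fin 3 → ℕ} {a b c : ℕ} :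
    m = ![a, b, c] ↔ m 0 = a ∧ m 1 = b ∧ m 2 = c := by
  simp [funext_iff, Fin.forall_fin_succ]

theorem classify_S32 {m : Fin 3 → ℕ} {q : Fin 3 → ℚ} (h : IsIrreducibleExponent S32 m q)
    (hm : m 0 ≤ m 2) :
    (∃ s t : ℕ, 1 ≤ t ∧ m = ![2, 4 * t + 3, (2 * s + 1) * (2 * t + 1)]) ∨
      (m 0, m 1, m 2) ∈ exceptionalExponents32 := by
  have hn := h.numerics32
  have hb := h.1.root_exponent 1 rfl
  have hb' : m 1 - 1 + 1 = m 1 := by omega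
  rcases Nat.eq_or_lt_of_le hn.two_le_left with h2 | h3
  · left
    rw [← h2] at hn
    obtain ⟨s, t, ht, h1, hc⟩ := hn.of_two
    exact ⟨s, t, ht, vec_three_eq_iff.2 ⟨h2.symm, by omega, hc⟩⟩
  · right
    have := hn.of_three_le h3 hm
    rwa [hb'] at this

theorem IsIrreducibleExponent.swap32 {m : Fin 3 → ℕ} {q : Fin 3 → ℚ}
    (h : IsIrreducibleExponent S32 m q) :
    IsIrreducibleExponent S32 (m ∘ Equiv.swap 0 2) (q ∘ Equiv.swap 0 2) := by
  have hs : ∀ i, S32 (Equiv.swap 0 2 i) = (S32 i).map (Equiv.swap 0 2) := by decide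
  exact ⟨h.1.relabel _ hs, irreducible_relabel _ h.2.1.1 h.2.1.2 hs,
    (centralCharge_comp _ q).trans_lt h.2.2⟩

theorem sporadicTest_of_exceptional32 : exceptionalExponents32.all (fun p =>
    sporadicTest ((p.2.1 - 1) * p.2.2) (p.1 * p.2.2) ((p.2.1 - 1) * p.1)
      (p.1 * p.2.1 * p.2.2)) = true := by
  decide +kernel

theorem sporadic_of_exceptional32 {m : Fin 3 → ℕ} {q : Fin 3 → ℚ}
    (h : IsIrreducibleExponent S32 m q) (hm : (m 0, m 1, m 2) ∈ exceptionalExponents32) :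
    chargesOf q ∈ sporadicCharges := by
  rw [eq_of_isFeasible_S32 h.1]
  have ha := h.1.pointer_exponent 0 1 rfl
  have hb := h.1.root_exponent 1 rfl
  have hc := h.1.pointer_exponent 2 1 rfl
  exact mem_sporadicCharges_of_test (by positivity)
    (List.all_eq_true.1 sporadicTest_of_exceptional32 _ hm)

theorem sporadic_of_S32 {m : Fin 3 → ℕ} {q : Fin 3 → ℚ} (h : IsIrreducibleExponent S32 m q)
    (hm : m ∉ infiniteExponents32) : chargesOf q ∈ sporadicCharges := by
  rcases le_total (m 0) (m 2) with hle | hle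
  · rcases classify_S32 h hle with ⟨s, t, ht, rfl⟩ | hex
    · exact absurd ⟨s, t, ht, Or.inl rfl⟩ hm
    · exact sporadic_of_exceptional32 h hex
  · rcases classify_S32 h.swap32 (by simpa using hle) with ⟨s, t, ht, h'⟩ | hex
    · refine absurd ⟨s, t, ht, Or.inr ?_⟩ hm
      rw [vec_three_eq_iff] at h' ⊢
      simpa [and_comm, and_assoc, and_left_comm, Equiv.swap_apply_of_ne_of_ne] using h'
    · rw [← chargesOf_comp (Equiv.swap 0 2)]
      exact sporadic_of_exceptional32 h.swap32 hex

theorem charges32_of_infinite_left {q : Fin 3 → ℚ} {s t : ℕ}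
    (ht : 1 ≤ t) (h : IsFeasible S32 ![2, 4 * t + 3, (2 * s + 1) * (2 * t + 1)] q) :
    chargesOf q ∈ charges32 := by
  have e0 := h.pointer_charge 0 1 rfl
  have e1 := h.root_charge 1 rfl
  have e2 := h.pointer_charge 2 1 rfl
  simp at e0 e1 e2
  rw [chargesOf_three]
  have h1 : (4 * t + 3 : ℚ) ≠ 0 := by positivity
  have h2 : (2 * t + 1 : ℚ) ≠ 0 := by positivity
  have f1 : q 1 = 1 / (4 * t + 3) := by rw [eq_div_iff h1]; linear_combination e1
  rw [f1] at e0 e2 ⊢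
  refine ⟨t, s, ht, triple_congr ?_ rfl ?_⟩
  · rw [eq_div_iff h1]
    field_simp at e0
    linear_combination e0 / 2
  · rw [eq_div_iff (by positivity)]
    field_simp at e2
    apply mul_left_cancel₀ h2
    linear_combination e2

theorem charges32_of_infinite {m : Fin 3 → ℕ} {q : Fin 3 → ℚ} (h : IsIrreducibleExponent S32 m q)
    (hm : m ∈ infiniteExponents32) : chargesOf q ∈ charges32 := by
  obtain ⟨s, t, ht, rfl | rfl⟩ := hm
  · exact charges32_of_infinite_left ht h.1
  · rw [← chargesOf_comp (Equiv.swap 0 2)]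
    refine charges32_of_infinite_left (s := s) ht ?_
    convert h.swap32.1 using 1
    ext i
    fin_cases i <;> rfl

theorem isIrreducibleExponent_S32_family {s t : ℕ} (ht : 1 ≤ t) :
    IsIrreducibleExponent S32 ![2, 4 * t + 3, (2 * s + 1) * (2 * t + 1)]
      ![(((2 * t + 1) * (2 * s + 1) : ℕ) : ℚ) / ((4 * t + 3) * (2 * s + 1) : ℕ),
        ((2 * s + 1 : ℕ) : ℚ) / ((4 * t + 3) * (2 * s + 1) : ℕ),
        ((2 : ℕ) : ℚ) / ((4 * t + 3) * (2 * s + 1) : ℕ)] := by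
  rw [isIrreducibleExponent_S32_div_iff (by positivity)]
  -- The link monomial is `X₁ * X₃ ^ ((t + 1) * (2 * s + 1))`.
  refine ⟨⟨⟨?_, ?_⟩, ⟨?_, ?_⟩, ⟨?_, ?_⟩, 1, (t + 1) * (2 * s + 1), ?_⟩, ⟨?_, ?_⟩, ?_⟩
  · simp
  · simp
  · simp
  · simp; ring
  · simp; nlinarith
  · simp; ring
  · ring
  · intro h
    have h := Nat.dvd_of_mul_dvd_mul_right (by omega) h
    obtain ⟨k, hk⟩ := h
    have : k < 3 := by
      by_contra! h3
      nlinarith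
    interval_cases k <;> omega
  · rw [Nat.prime_two.dvd_mul]
    omega
  · nlinarith

theorem charges32_subset : charges32 ⊆ irreducibleChargesOutside S32 ∅ := by
  rintro Q ⟨k, l, hk, rfl⟩
  refine ⟨_, _, isIrreducibleExponent_S32_family (s := l) hk, Set.notMem_empty _, ?_⟩
  rw [chargesOf_three]
  refine triple_congr ?_ ?_ ?_ <;> simp <;> field_simp

theorem isIrreducibleExponent_S32_exceptional {a b c α β : ℕ}
    (h : 2 ≤ a ∧ 3 ≤ b ∧ 2 ≤ c ∧ α * ((b - 1) * c) + β * ((b - 1) * a) = a * b * c ∧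
      ¬ (b - 1) * c ∣ a * b * c ∧ ¬ (b - 1) * a ∣ a * b * c ∧
      a * b * c < 2 * ((b - 1) * c + a * c + (b - 1) * a)) :
    ∃ q, IsIrreducibleExponent S32 ![a, b, c] q := by
  obtain ⟨ha, hb, hc, hl, hx, hz, hs⟩ := h
  refine ⟨![(((b - 1) * c : ℕ) : ℚ) / (a * b * c : ℕ), ((a * c : ℕ) : ℚ) / (a * b * c : ℕ),
    (((b - 1) * a : ℕ) : ℚ) / (a * b * c : ℕ)], ?_⟩
  rw [isIrreducibleExponent_S32_div_iff (by positivity)]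
  obtain ⟨e, rfl⟩ : ∃ e, b = e + 1 := ⟨b - 1, by omega⟩
  simp only [Nat.add_sub_cancel] at *
  refine ⟨⟨⟨hb, ?_⟩, ⟨ha, ?_⟩, ⟨hc, ?_⟩, α, β, hl⟩, ⟨hx, hz⟩, hs⟩
  all_goals simp; ring

theorem irreducible_S32_iff (m : Fin 3 → ℕ) (hm : m 0 ≤ m 2) :
    (∃ q, IsIrreducibleExponent S32 m q) ↔
      (∃ s t : ℕ, 1 ≤ t ∧ m = ![2, 4 * t + 3, (2 * s + 1) * (2 * t + 1)]) ∨
        m = ![3, 7, 4] ∨ m = ![3, 7, 8] ∨ m = ![3, 7, 10] ∨ m = ![3, 13, 4] ∨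
          m = ![3, 16, 5] := by
  constructor
  · rintro ⟨q, h⟩
    refine (classify_S32 h hm).imp id fun h => ?_
    simpa [exceptionalExponents32, vec_three_eq_iff] using h
  · rintro (⟨s, t, ht, rfl⟩ | rfl | rfl | rfl | rfl | rfl)
    · exact ⟨_, isIrreducibleExponent_S32_family ht⟩
    · exact isIrreducibleExponent_S32_exceptional (α := 2) (β := 2) (by decide)
    · exact isIrreducibleExponent_S32_exceptional (α := 2) (β := 4) (by decide)
    · exact isIrreducibleExponent_S32_exceptional (α := 2) (β := 5) (by decide)
    · exact isIrreducibleExponent_S32_exceptional (α := 1) (β := 3) (by decide)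
    · exact isIrreducibleExponent_S32_exceptional (α := 2) (β := 2) (by decide)

/-! The graph `X₁ ⇄ X₂ ← X₃`. -/

/-- The numerical conditions for irreducible exponents `A + 1, B + 1, c` on `S34`. -/
structure IrreducibleNumerics34 (A B c : ℕ) : Prop where
  two_le : 2 ≤ c
  not_dvd_right : ¬ A ∣ B
  not_dvd_left : ¬ B ∣ A
  not_dvd : ¬ (A + 1) * B ∣ c * (A * B + A + B)
  link : ∃ α β : ℕ, α * (c * B) + β * ((A + 1) * B) = c * (A * B + A + B)
  charge : c * (A * B + A + B) < 2 * (c * B + c * A + (A + 1) * B)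

theorem eq_of_isFeasible_S34 {m : Fin 3 → ℕ} {q : Fin 3 → ℚ} (h : IsFeasible S34 m q) {A B : ℕ}
    (hA : m 0 = A + 1) (hB : m 1 = B + 1) :
    q = ![((m 2 * B : ℕ) : ℚ) / (m 2 * (A * B + A + B) : ℕ),
      ((m 2 * A : ℕ) : ℚ) / (m 2 * (A * B + A + B) : ℕ),
      (((A + 1) * B : ℕ) : ℚ) / (m 2 * (A * B + A + B) : ℕ)] := by
  have ha := h.pointer_exponent 0 1 rfl
  have hb := h.pointer_exponent 1 0 rfl
  have hc := h.pointer_exponent 2 1 rfl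
  have e0 := h.pointer_charge 0 1 rfl
  have e1 := h.pointer_charge 1 0 rfl
  have e2 := h.pointer_charge 2 1 rfl
  rw [hA] at e0
  rw [hB] at e1
  have hd : (m 2 : ℚ) * (A * B + A + B) ≠ 0 := by
    have hA0 : 0 < A := by omega
    have hB0 : 0 < B := by omega
    positivity
  push_cast at *
  ext i
  fin_cases i <;> simp <;> rw [eq_div_iff hd]
  · linear_combination (m 2 : ℚ) * ((B + 1) * e0 - e1)
  · linear_combination (m 2 : ℚ) * ((A + 1) * e1 - e0)
  · linear_combination (A * B + A + B : ℚ) * e2 - ((A + 1) * e1 - e0)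

theorem IsIrreducibleExponent.numerics34 {m : Fin 3 → ℕ} {q : Fin 3 → ℚ}
    (h : IsIrreducibleExponent S34 m q) {A B : ℕ} (hA : m 0 = A + 1) (hB : m 1 = B + 1) :
    IrreducibleNumerics34 A B (m 2) := by
  have hq := eq_of_isFeasible_S34 h.1 hA hB
  have ha := h.1.pointer_exponent 0 1 rfl
  have hc := h.1.pointer_exponent 2 1 rfl
  have hA0 : 0 < A := by omega
  rw [hq, isIrreducibleExponent_S34_div_iff (by positivity)] at h
  obtain ⟨⟨-, -, -, hl⟩, ⟨hx, hy, hz⟩, hs⟩ := h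
  refine ⟨hc, fun h => hy ?_, fun h => hx ?_, hz, hl, hs⟩
  · exact Nat.mul_dvd_mul_left _
      ((Nat.dvd_add_right (Dvd.intro _ (by ring : A * (B + 1) = A * B + A))).2 h)
  · rw [show A * B + A + B = (A + 1) * B + A by ring]
    exact Nat.mul_dvd_mul_left _ ((Nat.dvd_add_right (Dvd.intro_left _ rfl)).2 h)

namespace IrreducibleNumerics34

variable {A B c : ℕ}

theorem two_le_left (h : IrreducibleNumerics34 A B c) : 2 ≤ A := by
  by_contra! hA
  interval_cases A
  · exact h.not_dvd_left (dvd_zero _)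
  · exact h.not_dvd_right (one_dvd _)

theorem two_le_right (h : IrreducibleNumerics34 A B c) : 2 ≤ B := by
  by_contra! hB
  interval_cases B
  · exact h.not_dvd_right (dvd_zero _)
  · exact h.not_dvd_left (one_dvd _)

theorem dvd_mul (h : IrreducibleNumerics34 A B c) : B ∣ c * A := by
  obtain ⟨α, β, h⟩ := h.link
  have h1 : B ∣ c * (A * B + A + B) := ⟨α * c + β * (A + 1), by rw [← h]; ring⟩
  rw [show c * (A * B + A + B) = B * (c * (A + 1)) + c * A by ring] at h1
  exact (Nat.dvd_add_right (Dvd.intro _ rfl)).1 h1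

/-- The link equation divided by `B`. Once `c` and `B` are fixed or parametrized, it is read modulo
`c` to restrict `A`. -/
theorem link_div (h : IrreducibleNumerics34 A B c) {k : ℕ} (hk : c * A = B * k) :
    ∃ α β : ℕ, α * c + β * (A + 1) = c * (A + 1) + k := by
  have hB := h.two_le_right
  obtain ⟨α, β, h⟩ := h.link
  refine ⟨α, β, Nat.eq_of_mul_eq_mul_left (show 0 < B by omega) ?_⟩
  linarith

theorem prime_dvd (h : IrreducibleNumerics34 A B c) (hc : c.Prime) : c ∣ B := by
  by_contra hB
  exact h.not_dvd_left (((hc.coprime_iff_not_dvd.2 hB).symm).dvd_of_dvd_mul_left h.dvd_mul)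

/-- Here `B = 2 * e` and `A = e * f`, where `f` is odd because `B ∤ A`, and `f ≠ 1` because `A ∤ B`.
If `e` were odd, `A + 1` would be even and the divided link equation would equate an even with an
odd number. -/
theorem of_two (h : IrreducibleNumerics34 A B 2) :
    ∃ s t : ℕ, 1 ≤ s ∧ 1 ≤ t ∧ A = 2 * t * (2 * s + 1) ∧ B = 4 * t := by
  obtain ⟨e, rfl⟩ := h.prime_dvd Nat.prime_two
  obtain ⟨f, rfl⟩ := Nat.dvd_of_mul_dvd_mul_left two_pos h.dvd_mul
  have hf : f % 2 = 1 := by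
    by_contra hf
    obtain ⟨g, rfl⟩ : ∃ g, f = 2 * g := ⟨f / 2, by omega⟩
    exact h.not_dvd_left ⟨g, by ring⟩
  have hf1 : f ≠ 1 := by
    rintro rfl
    exact h.not_dvd_right ⟨2, by ring⟩
  obtain ⟨α, β, hl⟩ := h.link_div (k := f) (by ring)
  have he : e % 2 = 0 := by
    by_contra he
    have hef : (e * f) % 2 = 1 := by
      rw [Nat.mul_mod, hf, show e % 2 = 1 by omega]
    obtain ⟨g, hg⟩ : ∃ g, e * f + 1 = 2 * g := ⟨(e * f + 1) / 2, by omega⟩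
    rw [hg, show β * (2 * g) = 2 * (β * g) by ring] at hl
    omega
  have := h.two_le_left
  refine ⟨f / 2, e / 2, by omega, ?_, ?_, by omega⟩
  · by_contra h0
    rw [show e = 0 by omega] at this
    omega
  · congr 1 <;> omega

/-- `A` is not a multiple of `3`. If `A + 1` were one, the link equation modulo `3` would make `A` a
multiple of `3` after all. -/
theorem of_three (h : IrreducibleNumerics34 A 3 3) : ∃ s : ℕ, 2 ≤ s ∧ A + 2 = 3 * s := by
  obtain ⟨α, β, hl⟩ := h.link_div rfl
  have h3 := h.not_dvd_left
  have h1 : A ≠ 1 := fun h1 => h.not_dvd_right (h1 ▸ one_dvd _)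
  have h2 : A % 3 ≠ 2 := by
    intro h2
    obtain ⟨g, hg⟩ : ∃ g, A + 1 = 3 * g := ⟨(A + 1) / 3, by omega⟩
    rw [hg, show β * (3 * g) = 3 * (β * g) by ring] at hl
    omega
  exact ⟨(A + 2) / 3, by omega, by omega⟩

/-- `A` is odd. If `4` divided `A + 1`, the link equation modulo `4` would give `4 ∣ 2 * A`. -/
theorem of_four (h : IrreducibleNumerics34 A 2 4) : ∃ s : ℕ, 1 ≤ s ∧ A = 4 * s + 1 := by
  obtain ⟨α, β, hl⟩ := h.link_div (k := 2 * A) (by ring)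
  have h2 := h.not_dvd_left
  have h1 : A ≠ 1 := fun h1 => h.not_dvd_right (h1 ▸ one_dvd _)
  have h4 : A % 4 ≠ 3 := by
    intro h4
    obtain ⟨g, hg⟩ : ∃ g, A + 1 = 4 * g := ⟨(A + 1) / 4, by omega⟩
    rw [hg, show β * (4 * g) = 4 * (β * g) by ring] at hl
    omega
  exact ⟨A / 4, by omega, by omega⟩

/-- In the charge inequality `A` has the coefficient `(c - 2) * (B - 1) - 2`. For `c ≥ 3` it fails
to be positive only at the two excluded pairs and at `c = 3`, `B = 2`, which contradicts `3 ∣ B`.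
The bound on `A` comes from `c = 3`, `B = 6`, the bound on `c` from `A = 2`, `B = 3`. -/
theorem bounds (h : IrreducibleNumerics34 A B c) (hc : 3 ≤ c) (h33 : ¬ (c = 3 ∧ B = 3))
    (h42 : ¬ (c = 4 ∧ B = 2)) : A < 10 ∧ c < 18 := by
  have hs := h.charge
  have hA := h.two_le_left
  have hB := h.two_le_right
  rcases Nat.eq_or_lt_of_le hc with rfl | hc
  · have hB6 : 6 ≤ B := by
      have := h.prime_dvd Nat.prime_three
      omega
    refine ⟨?_, by omega⟩
    by_contra! hA
    nlinarith
  rcases Nat.eq_or_lt_of_le hB with rfl | hB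
  · have hA2 := h.not_dvd_left
    have hc2 : 2 ∣ c := (Nat.prime_two.dvd_mul.1 h.dvd_mul).resolve_right hA2
    have hc6 : 6 ≤ c := by omega
    have hA3 : 3 ≤ A := by omega
    constructor <;> by_contra! hcon <;> nlinarith
  constructor
  · by_contra! hcon
    obtain ⟨i, rfl⟩ := Nat.exists_eq_add_of_le hc
    obtain ⟨j, rfl⟩ := Nat.exists_eq_add_of_le hB
    obtain ⟨k, rfl⟩ := Nat.exists_eq_add_of_le hcon
    simp only [Nat.succ_eq_add_one] at hs
    nlinarith [Nat.zero_le (i * j), Nat.zero_le (i * k), Nat.zero_le (j * k),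
      Nat.zero_le (i * j * k)]
  · by_contra! hcon
    obtain ⟨i, rfl⟩ := Nat.exists_eq_add_of_le hcon
    obtain ⟨j, rfl⟩ := Nat.exists_eq_add_of_le hB
    rcases Nat.eq_or_lt_of_le hA with rfl | hA
    · simp only [Nat.succ_eq_add_one] at hs
      nlinarith [Nat.zero_le (i * j)]
    · obtain ⟨k, rfl⟩ := Nat.exists_eq_add_of_le hA
      simp only [Nat.succ_eq_add_one] at hs
      nlinarith [Nat.zero_le (i * j), Nat.zero_le (i * k), Nat.zero_le (j * k),
        Nat.zero_le (i * j * k)]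

end IrreducibleNumerics34

/-- The numerators belong to irreducible exponents on `S34` outside the infinite families. -/
def Candidate34 (A c B : ℕ) : Prop :=
  3 ≤ c ∧ B ∣ c * A ∧ ¬ B ∣ A ∧ ¬ A ∣ B ∧ ¬ (c = 3 ∧ B = 3) ∧ ¬ (c = 4 ∧ B = 2) ∧
    c * (A * B + A + B) < 2 * (c * B + c * A + (A + 1) * B) ∧
    ¬ (A + 1) * B ∣ c * (A * B + A + B) ∧
    linkTest (c * B) ((A + 1) * B) (c * (A * B + A + B)) = true

instance (A c B : ℕ) : Decidable (Candidate34 A c B) := by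
  unfold Candidate34
  infer_instance

theorem sporadicTest_of_candidate34 : allBelow 10 18 154 (fun A c B =>
    !decide (Candidate34 A c B) ||
      sporadicTest (c * B) (c * A) ((A + 1) * B) (c * (A * B + A + B))) = true := by
  decide +kernel

theorem sporadic_of_S34 {m : Fin 3 → ℕ} {q : Fin 3 → ℚ} (h : IsIrreducibleExponent S34 m q)
    (hm : m ∉ infiniteExponents34) : chargesOf q ∈ sporadicCharges := by
  have ha := h.1.pointer_exponent 0 1 rfl
  have hb := h.1.pointer_exponent 1 0 rfl
  obtain ⟨A, hA⟩ : ∃ A, m 0 = A + 1 := ⟨m 0 - 1, by omega⟩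
  obtain ⟨B, hB⟩ : ∃ B, m 1 = B + 1 := ⟨m 1 - 1, by omega⟩
  have hn := h.numerics34 hA hB
  rw [eq_of_isFeasible_S34 h.1 hA hB]
  have hA2 := hn.two_le_left
  have hB2 := hn.two_le_right
  rcases Nat.eq_or_lt_of_le hn.two_le with hc | hc
  · rw [← hc] at hn
    obtain ⟨s, t, hs, ht, rfl, rfl⟩ := hn.of_two
    exact absurd (Or.inl ⟨s, t, hs, ht, vec_three_eq_iff.2 ⟨hA, hB, hc.symm⟩⟩) hm
  have h33 : ¬ (m 2 = 3 ∧ B = 3) := by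
    rintro ⟨hc, rfl⟩
    rw [hc] at hn
    obtain ⟨s, hs, hAs⟩ := hn.of_three
    exact hm (Or.inr (Or.inr ⟨s, hs, vec_three_eq_iff.2 ⟨by omega, hB, hc⟩⟩))
  have h42 : ¬ (m 2 = 4 ∧ B = 2) := by
    rintro ⟨hc, rfl⟩
    rw [hc] at hn
    obtain ⟨s, hs, hAs⟩ := hn.of_four
    exact hm (Or.inr (Or.inl ⟨s, hs, vec_three_eq_iff.2 ⟨by omega, hB, hc⟩⟩))
  obtain ⟨hA10, hc18⟩ := hn.bounds hc h33 h42
  -- `B` is bounded through `B ∣ c * A`, with `A ≤ 9` and `c ≤ 17`.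
  have hB154 : B < 154 := by
    refine lt_of_le_of_lt (Nat.le_of_dvd (Nat.mul_pos (by omega) (by omega)) hn.dvd_mul) ?_
    have : m 2 * A ≤ 17 * 9 := Nat.mul_le_mul (by omega) (by omega)
    omega
  have key := allBelow_apply sporadicTest_of_candidate34 hA10 hc18 hB154
  have hcand : Candidate34 A (m 2) B := ⟨hc, hn.dvd_mul, hn.not_dvd_left, hn.not_dvd_right, h33,
    h42, hn.charge, hn.not_dvd, linkTest_of_exists (by positivity) hn.link⟩
  simp only [hcand, decide_true, Bool.not_true, Bool.false_or] at key
  exact mem_sporadicCharges_of_test (by positivity) key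

theorem charges34_of_infinite {m : Fin 3 → ℕ} {q : Fin 3 → ℚ} (h : IsIrreducibleExponent S34 m q)
    (hm : m ∈ infiniteExponents34) : chargesOf q ∈ charges34 := by
  have e0 := h.1.pointer_charge 0 1 rfl
  have e1 := h.1.pointer_charge 1 0 rfl
  have e2 := h.1.pointer_charge 2 1 rfl
  rw [chargesOf_three]
  rcases hm with ⟨s, t, hs, ht, rfl⟩ | ⟨s, hs, rfl⟩ | ⟨s, hs, rfl⟩
  · simp at e0 e1 e2
    have hQ : (8 * t * s + 4 * t + 2 * s + 3 : ℚ) ≠ 0 := by positivity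
    -- The first two equations have determinant `2 * t * Q`, where `Q` is the denominator in `hQ`;
    -- the common factor `t` has to be cancelled.
    have ht0 : (t : ℚ) ≠ 0 := by norm_cast; omega
    have f0 : q 0 * (8 * t * s + 4 * t + 2 * s + 3) = 2 := by
      apply mul_left_cancel₀ ht0
      linear_combination ((4 * t + 1) * e0 - e1) / 2
    have f1 : q 1 * (8 * t * s + 4 * t + 2 * s + 3) = 2 * s + 1 := by
      apply mul_left_cancel₀ ht0
      linear_combination (((2 * t * (2 * s + 1) + 1) * e1 - e0)) / 2
    refine Or.inl ⟨t, s, ht, hs, triple_congr ?_ ?_ ?_⟩ <;> rw [eq_div_iff hQ]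
    · exact f0
    · exact f1
    · linear_combination (8 * t * s + 4 * t + 2 * s + 3) / 2 * e2 - f1 / 2
  · simp at e0 e1 e2
    have hQ : (12 * s + 5 : ℚ) ≠ 0 := by positivity
    refine Or.inr (Or.inr ⟨s, hs, triple_congr ?_ ?_ ?_⟩) <;> rw [eq_div_iff hQ]
    · linear_combination 3 * e0 - e1
    · linear_combination (4 * s + 2) * e1 - e0
    · linear_combination (12 * s + 5) / 4 * e2 - ((4 * s + 2) * e1 - e0) / 4
  · obtain ⟨s, rfl⟩ := Nat.exists_eq_add_of_le hs
    simp [show 3 * (2 + s) - 1 = 3 * s + 5 by omega] at e0 e1 e2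
    have hQ : (12 * ((2 + s : ℕ) : ℚ) - 5) ≠ 0 := by
      push_cast
      have : (0 : ℚ) ≤ s := by positivity
      linarith
    refine Or.inr (Or.inl ⟨2 + s, hs, triple_congr ?_ ?_ ?_⟩) <;> rw [eq_div_iff hQ] <;> push_cast
    · linear_combination 4 * e0 - e1
    · linear_combination (3 * s + 5) * e1 - e0
    · linear_combination (12 * s + 19) / 3 * e2 - ((3 * s + 5) * e1 - e0) / 3

theorem mem_irreducibleChargesOutside_S34 {m : Fin 3 → ℕ} {x y z d : ℕ} (hd : 0 < d)
    (h : ((2 ≤ m 0 ∧ m 0 * x + y = d) ∧ (2 ≤ m 1 ∧ m 1 * y + x = d) ∧ (2 ≤ m 2 ∧ m 2 * z + y = d) ∧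
        ∃ a b : ℕ, a * x + b * z = d) ∧
      (¬ x ∣ d ∧ ¬ y ∣ d ∧ ¬ z ∣ d) ∧ d < 2 * (x + y + z)) :
    ({(x : ℚ) / d, (y : ℚ) / d, (z : ℚ) / d} : Multiset ℚ) ∈ irreducibleChargesOutside S34 ∅ :=
  ⟨m, _, (isIrreducibleExponent_S34_div_iff hd).2 h, Set.notMem_empty _, rfl⟩

theorem charges34_subset : charges34 ⊆ irreducibleChargesOutside S34 ∅ := by
  rintro Q (⟨k, l, hk, hl, rfl⟩ | ⟨k, hk, rfl⟩ | ⟨k, hk, rfl⟩)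
  · have h := mem_irreducibleChargesOutside_S34 (m := ![2 * k * (2 * l + 1) + 1, 4 * k + 1, 2])
      (x := 2) (y := 2 * l + 1) (z := 2 * k * (2 * l + 1) + 1)
      (d := 8 * k * l + 4 * k + 2 * l + 3) (by positivity) ?_
    · simpa using h
    have hkl : 1 ≤ k * l := Nat.mul_pos hk hl
    have hd : 8 * k * l + 4 * k + 2 * l + 3 = (2 * l + 1) * (4 * k + 1) + 2 := by ring
    have hd' : 8 * k * l + 4 * k + 2 * l + 3 =
      (2 * k * (2 * l + 1) + 1) * 2 + (2 * l + 1) := by ring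
    -- The link monomial is `X₁ ^ (k * (2 * l + 1) + l + 1) * X₃`. Non-divisibility is seen by
    -- division with remainder, as in the two families below.
    refine ⟨⟨⟨?_, ?_⟩, ⟨?_, ?_⟩, ⟨?_, ?_⟩, k * (2 * l + 1) + l + 1, 1, ?_⟩, ⟨?_, ?_, ?_⟩, ?_⟩
    · simp; nlinarith
    · simp; ring
    · simp; omega
    · simp; ring
    · simp
    · simp; ring
    · ring
    · rw [show 8 * k * l + 4 * k + 2 * l + 3 = 2 * (4 * k * l + 2 * k + l + 1) + 1 by ring]
      omega
    · rw [hd, Nat.dvd_add_right (Dvd.intro _ rfl)]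
      intro h
      have := Nat.le_of_dvd two_pos h
      omega
    · rw [hd', Nat.dvd_add_right (Dvd.intro _ rfl)]
      intro h
      have := Nat.le_of_dvd (by omega) h
      nlinarith
    · nlinarith
  · obtain ⟨k, rfl⟩ := Nat.exists_eq_add_of_le hk
    have h := mem_irreducibleChargesOutside_S34 (m := ![3 * k + 5, 4, 3])
      (x := 3) (y := 3 * k + 4) (z := 3 * k + 5) (d := 12 * k + 19) (by positivity) ?_
    · convert h using 1
      push_cast
      refine triple_congr ?_ ?_ ?_ <;> congr 1 <;> ring
    refine ⟨⟨⟨?_, ?_⟩, ⟨?_, ?_⟩, ⟨?_, ?_⟩, 2 * k + 3, 2, ?_⟩, ⟨?_, ?_, ?_⟩, ?_⟩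
    · simp
    · simp; ring
    · simp
    · simp; ring
    · simp
    · simp; ring
    · ring
    · omega
    · rw [show 12 * k + 19 = (3 * k + 4) * 4 + 3 by ring, Nat.dvd_add_right (Dvd.intro _ rfl)]
      intro h
      have := Nat.le_of_dvd (by omega) h
      omega
    · rw [show 12 * k + 19 = (3 * k + 5) * 3 + (3 * k + 4) by ring,
        Nat.dvd_add_right (Dvd.intro _ rfl)]
      intro h
      have := Nat.le_of_dvd (by omega) h
      omega
    · omega
  · have h := mem_irreducibleChargesOutside_S34 (m := ![4 * k + 2, 3, 4])
      (x := 2) (y := 4 * k + 1) (z := 2 * k + 1) (d := 12 * k + 5) (by positivity) ?_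
    · simpa using h
    refine ⟨⟨⟨?_, ?_⟩, ⟨?_, ?_⟩, ⟨?_, ?_⟩, 5 * k + 2, 1, ?_⟩, ⟨?_, ?_, ?_⟩, ?_⟩
    · simp
    · simp; ring
    · simp
    · simp; ring
    · simp
    · simp; ring
    · ring
    · omega
    · rw [show 12 * k + 5 = (4 * k + 1) * 3 + 2 by ring, Nat.dvd_add_right (Dvd.intro _ rfl)]
      intro h
      have := Nat.le_of_dvd (by omega) h
      omega
    · rw [show 12 * k + 5 = (2 * k + 1) * 5 + 2 * k by ring, Nat.dvd_add_right (Dvd.intro _ rfl)]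
      intro h
      have := Nat.le_of_dvd (by omega) h
      omega
    · omega

/-! The list of sporadic charges. -/

theorem exists_of_linkTest {x z d : ℕ} (h : linkTest x z d = true) :
    ∃ a b : ℕ, a * x + b * z = d := by
  simp only [linkTest, List.any_eq_true, List.mem_range, decide_eq_true_eq] at h
  obtain ⟨b, hb, a, ha⟩ := h
  have : b * z ≤ d := (Nat.mul_le_mul_right z (Nat.lt_succ_iff.1 hb)).trans (Nat.div_mul_le_self d z)
  exact ⟨a, b, by rw [mul_comm a, ← ha]; omega⟩

/-- The charges `x / d`, `y / d`, `z / d` come from irreducible exponents `a, b, c` on `S31`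
outside the infinite families. -/
def Origin31 (a b c x y z d : ℕ) : Prop :=
  (3 ≤ c ∧ c * z = d) ∧ (3 ≤ a ∧ a * x + y = d) ∧ (3 ≤ b ∧ b * y + z = d) ∧
    2 < (b - 2) * (c - 2) ∧ 4 < (a - 2) * (c - 2) ∧ 2 < (a - 2) * (b - 2) ∧
    (¬ x ∣ d ∧ ¬ y ∣ d) ∧ d < 2 * (x + y + z)

/-- The analogue of `Origin31` for `S32`. -/
def Origin32 (a b c x y z d : ℕ) : Prop :=
  (3 ≤ b ∧ b * y = d) ∧ (3 ≤ a ∧ a * x + y = d) ∧ (3 ≤ c ∧ c * z + y = d) ∧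
    linkTest x z d = true ∧ (¬ x ∣ d ∧ ¬ z ∣ d) ∧ d < 2 * (x + y + z)

/-- The analogue of `Origin31` for `S33`. -/
def Origin33 (a b c x y z d : ℕ) : Prop :=
  (3 ≤ a ∧ a * x + y = d) ∧ (3 ≤ b ∧ b * y + z = d) ∧ (3 ≤ c ∧ c * z + x = d) ∧
    2 < (a - 2) * (b - 2) ∧ 2 < (b - 2) * (c - 2) ∧ 2 < (c - 2) * (a - 2) ∧
    (¬ x ∣ d ∧ ¬ y ∣ d ∧ ¬ z ∣ d) ∧ d < 2 * (x + y + z)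

/-- The analogue of `Origin31` for `S34`. -/
def Origin34 (a b c x y z d : ℕ) : Prop :=
  (2 ≤ a ∧ a * x + y = d) ∧ (2 ≤ b ∧ b * y + x = d) ∧ (3 ≤ c ∧ c * z + y = d) ∧
    ¬ (b = 3 ∧ c = 4) ∧ ¬ (b = 4 ∧ c = 3) ∧
    linkTest x z d = true ∧ (¬ x ∣ d ∧ ¬ y ∣ d ∧ ¬ z ∣ d) ∧ d < 2 * (x + y + z)

instance (a b c x y z d : ℕ) : Decidable (Origin31 a b c x y z d) := by
  unfold Origin31
  infer_instance

instance (a b c x y z d : ℕ) : Decidable (Origin32 a b c x y z d) := by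
  unfold Origin32
  infer_instance

instance (a b c x y z d : ℕ) : Decidable (Origin33 a b c x y z d) := by
  unfold Origin33
  infer_instance

instance (a b c x y z d : ℕ) : Decidable (Origin34 a b c x y z d) := by
  unfold Origin34
  infer_instance

/-- The charges of irreducible exponents outside the infinite families. -/
def chargesOutside : Set (Multiset ℚ) :=
  irreducibleChargesOutside S31 infiniteExponents31 ∪
    irreducibleChargesOutside S32 infiniteExponents32 ∪
    irreducibleChargesOutside S33 infiniteExponents33 ∪
    irreducibleChargesOutside S34 infiniteExponents34

/-- The exponents are determined by the charges. -/
def HasOrigin (x y z d : ℕ) : Prop :=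
  Origin31 ((d - y) / x) ((d - z) / y) (d / z) x y z d ∨
    Origin32 ((d - y) / x) (d / y) ((d - y) / z) x y z d ∨
    Origin33 ((d - y) / x) ((d - z) / y) ((d - x) / z) x y z d ∨
    Origin34 ((d - y) / x) ((d - x) / y) ((d - y) / z) x y z d

instance (x y z d : ℕ) : Decidable (HasOrigin x y z d) := by
  unfold HasOrigin
  infer_instance

/-- The entries are sorted, while a skeleton distinguishes its nodes, so all six orders are tried.
-/
theorem hasOrigin_of_mem : sporadicData.all (fun p =>
    decide (HasOrigin p.1 p.2.1 p.2.2.1 p.2.2.2 ∨ HasOrigin p.1 p.2.2.1 p.2.1 p.2.2.2 ∨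
      HasOrigin p.2.1 p.1 p.2.2.1 p.2.2.2 ∨ HasOrigin p.2.1 p.2.2.1 p.1 p.2.2.2 ∨
      HasOrigin p.2.2.1 p.1 p.2.1 p.2.2.2 ∨ HasOrigin p.2.2.1 p.2.1 p.1 p.2.2.2)) = true := by
  decide +kernel

theorem mem_chargesOutside_of_hasOrigin {x y z d : ℕ} (hd : 0 < d) (h : HasOrigin x y z d) :
    ({(x : ℚ) / d, (y : ℚ) / d, (z : ℚ) / d} : Multiset ℚ) ∈ chargesOutside := by
  unfold HasOrigin at h
  -- Only the equations recorded in the origin conditions matter from here on; they already certify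
  -- that the divisions were exact.
  generalize (d - y) / x = a, (d - z) / y = b, d / z = c, d / y = b', (d - y) / z = c',
    (d - x) / z = c'', (d - x) / y = b'' at h
  rcases h with h | h | h | h
  · obtain ⟨hc, ha, hb, h1, h2, h3, hirr, hs⟩ := h
    refine Or.inl (Or.inl (Or.inl ⟨![a, b, c], ![(x : ℚ) / d, (y : ℚ) / d, (z : ℚ) / d],
      (isIrreducibleExponent_S31_div_iff hd).2 ⟨⟨hc, ⟨?_, ha.2⟩, ⟨?_, hb.2⟩⟩, hirr, hs⟩, ?_, rfl⟩))
    · exact le_trans (by norm_num) ha.1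
    · exact le_trans (by norm_num) hb.1
    · simp only [infiniteExponents31, Set.mem_ofPred_eq, Matrix.cons_val]
      clear hirr hs
      rintro (rfl | rfl | ⟨rfl, rfl⟩ | ⟨rfl, rfl⟩ | ⟨rfl, rfl⟩ | ⟨rfl, rfl⟩ | ⟨rfl, rfl⟩ |
        ⟨rfl, rfl⟩ | ⟨rfl, rfl⟩ | ⟨rfl, rfl⟩ | ⟨rfl, rfl⟩ | ⟨rfl, rfl⟩ | ⟨rfl, rfl⟩ | ⟨rfl, rfl⟩ |
        ⟨rfl, rfl⟩ | ⟨rfl, rfl⟩) <;> simp at *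
  · obtain ⟨hb, ha, hc, hl, hirr, hs⟩ := h
    refine Or.inl (Or.inl (Or.inr ⟨![a, b', c'], ![(x : ℚ) / d, (y : ℚ) / d, (z : ℚ) / d],
      (isIrreducibleExponent_S32_div_iff hd).2
        ⟨⟨hb, ⟨?_, ha.2⟩, ⟨?_, hc.2⟩, exists_of_linkTest hl⟩, hirr, hs⟩, ?_, rfl⟩))
    · exact le_trans (by norm_num) ha.1
    · exact le_trans (by norm_num) hc.1
    · rintro ⟨s, t, -, h | h⟩
      · have h : a = 2 := congrFun h 0
        omega
      · have h : c' = 2 := congrFun h 2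
        omega
  · obtain ⟨ha, hb, hc, h1, h2, h3, hirr, hs⟩ := h
    refine Or.inl (Or.inr ⟨![a, b, c''], ![(x : ℚ) / d, (y : ℚ) / d, (z : ℚ) / d],
      (isIrreducibleExponent_S33_div_iff hd).2
        ⟨⟨⟨?_, ha.2⟩, ⟨?_, hb.2⟩, ⟨?_, hc.2⟩⟩, hirr, hs⟩, ?_, rfl⟩)
    · exact le_trans (by norm_num) ha.1
    · exact le_trans (by norm_num) hb.1
    · exact le_trans (by norm_num) hc.1
    · have key : ∀ u v : ℕ, 3 ≤ u → 2 < (u - 2) * (v - 2) →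
          ¬ (u = 2 ∨ (u = 3 ∧ v = 3) ∨ (u = 3 ∧ v = 4) ∨ (u = 4 ∧ v = 3)) := by
        rintro u v hu h (rfl | ⟨rfl, rfl⟩ | ⟨rfl, rfl⟩ | ⟨rfl, rfl⟩) <;> simp at *
      rintro ⟨i, hi⟩
      fin_cases i
      · exact key a b ha.1 h1 hi
      · exact key b c'' hb.1 h2 hi
      · exact key c'' a hc.1 h3 hi
  · obtain ⟨ha, hb, hc, h1, h2, hl, hirr, hs⟩ := h
    refine Or.inr ⟨![a, b'', c'], ![(x : ℚ) / d, (y : ℚ) / d, (z : ℚ) / d],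
      (isIrreducibleExponent_S34_div_iff hd).2
        ⟨⟨ha, hb, ⟨?_, hc.2⟩, exists_of_linkTest hl⟩, hirr, hs⟩, ?_, rfl⟩
    · exact le_trans (by norm_num) hc.1
    · rintro (⟨s, t, -, -, h⟩ | ⟨s, -, h⟩ | ⟨s, -, h⟩) <;> rw [vec_three_eq_iff] at h <;>
        obtain ⟨-, hb', hc'⟩ := h
      · have hc' : c' = 2 := hc'
        omega
      · exact h1 ⟨hb', hc'⟩
      · exact h2 ⟨hb', hc'⟩

theorem chargesOutside_eq : chargesOutside = sporadicCharges := by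
  apply Set.Subset.antisymm
  · rintro Q (((⟨m, q, h, hm, rfl⟩ | ⟨m, q, h, hm, rfl⟩) | ⟨m, q, h, hm, rfl⟩) |
      ⟨m, q, h, hm, rfl⟩)
    · exact sporadic_of_S31 h hm
    · exact sporadic_of_S32 h hm
    · exact sporadic_of_S33 h hm
    · exact sporadic_of_S34 h hm
  · rintro Q ⟨x, y, z, d, hp, rfl⟩
    have hd : 0 < d := sporadicData_pos _ hp
    have h := of_decide_eq_true (List.all_eq_true.1 hasOrigin_of_mem _ hp)
    rcases h with h | h | h | h | h | h <;> have h' := mem_chargesOutside_of_hasOrigin hd h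
    · exact h'
    · rwa [multiset_swap_right]
    · rwa [multiset_swap]
    · rwa [multiset_rotate]
    · rwa [← multiset_rotate]
    · rwa [multiset_rotate, multiset_swap]

/-- The charges of an entry of the list of sporadic charges. -/
def entryCharges (p : ℕ × ℕ × ℕ × ℕ) : Multiset ℚ :=
  {(p.1 : ℚ) / p.2.2.2, (p.2.1 : ℚ) / p.2.2.2, (p.2.2.1 : ℚ) / p.2.2.2}

theorem sporadicData_sorted : sporadicData.all (fun p =>
    Nat.ble p.1 p.2.1 && Nat.ble p.2.1 p.2.2.1) = true := by
  decide +kernel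

/-- Cross-multiplied inequality of the charge triples, entry by entry. As the entries are sorted,
`sorted_triple_inj` turns this into distinctness of the unordered charges. -/
theorem sporadicData_pairwise : sporadicData.Pairwise fun p p' =>
    ¬ (p.2.2.1 * p'.2.2.2 = p'.2.2.1 * p.2.2.2 ∧ p.1 * p'.2.2.2 = p'.1 * p.2.2.2 ∧
      p.2.1 * p'.2.2.2 = p'.2.1 * p.2.2.2) := by
  decide +kernel

theorem sorted_triple_inj {x y z x' y' z' : ℚ} (hxy : x ≤ y) (hyz : y ≤ z) (hxy' : x' ≤ y')
    (hyz' : y' ≤ z') (h : ({x, y, z} : Multiset ℚ) = {x', y', z'}) :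
    x = x' ∧ y = y' ∧ z = z' := by
  have hp : [x, y, z].Perm [x', y', z'] := Multiset.coe_eq_coe.1 h
  have h1 : [x, y, z].Pairwise (· ≤ ·) := by simp [hxy, hyz, hxy.trans hyz]
  have h2 : [x', y', z'].Pairwise (· ≤ ·) := by simp [hxy', hyz', hxy'.trans hyz']
  simpa using hp.eq_of_pairwise (fun _ _ _ _ => le_antisymm) h1 h2

theorem entryCharges_nodup : (sporadicData.map entryCharges).Nodup := by
  rw [List.Nodup, List.pairwise_map]
  refine List.Pairwise.imp_of_mem ?_ sporadicData_pairwise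
  rintro ⟨x, y, z, d⟩ ⟨x', y', z', d'⟩ hp hp' hne heq
  have hd : (0 : ℚ) < d := by exact_mod_cast sporadicData_pos _ hp
  have hd' : (0 : ℚ) < d' := by exact_mod_cast sporadicData_pos _ hp'
  have hs := List.all_eq_true.1 sporadicData_sorted _ hp
  have hs' := List.all_eq_true.1 sporadicData_sorted _ hp'
  simp only [Bool.and_eq_true, Nat.ble_eq] at hs hs'
  have mono : ∀ {u v e : ℕ}, u ≤ v → (u : ℚ) / e ≤ (v : ℚ) / e := fun h => by gcongr
  obtain ⟨h1, h2, h3⟩ := sorted_triple_inj (mono hs.1) (mono hs.2) (mono hs'.1) (mono hs'.2) heq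
  rw [div_eq_div_iff hd.ne' hd'.ne'] at h1 h2 h3
  exact hne ⟨by exact_mod_cast h3, by exact_mod_cast h1, by exact_mod_cast h2⟩

theorem ncard_sporadicCharges : sporadicCharges.ncard = 236 := by
  classical
  have h : sporadicCharges = ↑(sporadicData.map entryCharges).toFinset := by
    ext Q
    simp only [List.coe_toFinset, List.mem_map, sporadicCharges, Set.mem_ofPred_eq]
    constructor
    · rintro ⟨x, y, z, d, hp, rfl⟩
      exact ⟨_, hp, rfl⟩
    · rintro ⟨⟨x, y, z, d⟩, hp, rfl⟩
      exact ⟨x, y, z, d, hp, rfl⟩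
  rw [h, Set.ncard_coe_finset, List.toFinset_card_of_nodup entryCharges_nodup, List.length_map]
  rfl

/-! Families in one and two variables. -/

theorem charges11_eq : charges11 = feasibleCharges S11 := by
  apply Set.Subset.antisymm
  · rintro Q ⟨k, hk, rfl⟩
    have hk0 : (0 : ℚ) < k := by norm_cast; omega
    refine ⟨![k], ![1 / (k : ℚ)], ?_, ?_, rfl⟩
    · constructor <;> simp [S11, hk, hk0.ne']
    · simp only [centralCharge, Fin.sum_univ_one, Matrix.cons_val_fin_one]
      have : 0 < 1 / (k : ℚ) := by positivity
      linarith
  · rintro Q ⟨m, q, h, -, rfl⟩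
    have h3 := h.root_exponent 0 rfl
    refine ⟨m 0, h3, ?_⟩
    rw [chargesOf_one, Multiset.singleton_inj, eq_div_iff (by norm_cast; omega), mul_comm]
    exact h.root_charge 0 rfl

/-- With at most two variables `c < 6` is automatic, so the families there are all feasible charges.
-/
theorem centralCharge_two_lt_six {q : Fin 2 → ℚ} (h0 : 0 < q 0) (h1 : 0 < q 1) :
    centralCharge q < 6 := by
  simp only [centralCharge, Fin.sum_univ_two]
  linarith

theorem charges21_eq : charges21 = feasibleCharges S21 := by
  apply Set.Subset.antisymm
  · rintro Q ⟨k, l, hk, hl, rfl⟩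
    have hk0 : (0 : ℚ) < k := by norm_cast; omega
    have hl0 : (0 : ℚ) < (l : ℚ) - 1 := by
      have : (3 : ℚ) ≤ l := by exact_mod_cast hl
      linarith
    have hl1 : (0 : ℚ) < l := by linarith
    refine ⟨![k, l], ![((l : ℚ) - 1) / (k * l), 1 / (l : ℚ)], ?_, ?_, rfl⟩
    · constructor <;> simp [S21, Fin.forall_fin_succ, hk, hl, hl1.ne']
      field_simp
      ring
    · apply centralCharge_two_lt_six <;> simp <;> positivity
  · rintro Q ⟨m, q, h, -, rfl⟩
    have ha := h.pointer_exponent 0 1 rfl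
    have hb := h.root_exponent 1 rfl
    have e0 := h.pointer_charge 0 1 rfl
    have e1 := h.root_charge 1 rfl
    have ha0 : (m 0 : ℚ) ≠ 0 := by norm_cast; omega
    have hb0 : (m 1 : ℚ) ≠ 0 := by norm_cast; omega
    refine ⟨m 0, m 1, ha, hb, ?_⟩
    rw [chargesOf_two]
    congr 1
    · rw [eq_div_iff (by positivity)]
      linear_combination (m 1 : ℚ) * e0 - e1
    · rw [Multiset.singleton_inj, eq_div_iff hb0]
      linear_combination e1

theorem charges22_eq : charges22 = feasibleCharges S22 := by
  have pos : ∀ k l : ℕ, 2 ≤ k → 2 ≤ l → (0 : ℚ) < k - 1 ∧ (0 : ℚ) < l - 1 ∧ (0 : ℚ) < k * l - 1 := by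
    intro k l hk hl
    have hk : (2 : ℚ) ≤ k := by exact_mod_cast hk
    have hl : (2 : ℚ) ≤ l := by exact_mod_cast hl
    refine ⟨by linarith, by linarith, by nlinarith⟩
  apply Set.Subset.antisymm
  · rintro Q ⟨k, l, hk, hl, rfl⟩
    obtain ⟨hk0, hl0, hkl⟩ := pos k l hk hl
    refine ⟨![k, l], ![((l : ℚ) - 1) / (k * l - 1), ((k : ℚ) - 1) / (k * l - 1)], ?_, ?_, rfl⟩
    · constructor <;> simp [S22, Fin.forall_fin_succ, hk, hl]
      constructor <;> rw [← mul_div_assoc, ← add_div, div_eq_one_iff_eq hkl.ne'] <;> ring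
    · apply centralCharge_two_lt_six <;> simp <;> positivity
  · rintro Q ⟨m, q, h, -, rfl⟩
    have ha := h.pointer_exponent 0 1 rfl
    have hb := h.pointer_exponent 1 0 rfl
    have e0 := h.pointer_charge 0 1 rfl
    have e1 := h.pointer_charge 1 0 rfl
    have hd := (pos _ _ ha hb).2.2.ne'
    refine ⟨m 0, m 1, ha, hb, ?_⟩
    rw [chargesOf_two]
    congr 1
    · rw [eq_div_iff hd]
      linear_combination (m 1 : ℚ) * e0 - e1
    · rw [Multiset.singleton_inj, eq_div_iff hd]
      linear_combination (m 0 : ℚ) * e1 - e0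

/-! Charges of generically compact families. -/

theorem charges_one {q : Fin 1 → ℚ} (hgc : GenericallyCompact q)
    (hirr : ¬ Decomposable q ∨ IrreducibleFamily q) : chargesOf q ∈ charges11 := by
  obtain ⟨t, m, ht, hf, -, -⟩ := exists_isFeasible hgc hirr
    (fun _ _ _ i j v hij _ _ => absurd (Subsingleton.elim i j) hij)
  have h0 : t 0 = none := by
    rw [Option.eq_none_iff_forall_ne_some]
    intro j hj
    exact ht 0 (hj.trans (by rw [Subsingleton.elim j 0]))
  refine ⟨m 0, hf.root_exponent 0 h0, ?_⟩
  have h3 := hf.root_exponent 0 h0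
  rw [chargesOf_one, Multiset.singleton_inj, eq_div_iff (by norm_cast; omega), mul_comm]
  exact hf.root_charge 0 h0

theorem charges_two {q : Fin 2 → ℚ} (hgc : GenericallyCompact q)
    (hirr : ¬ Decomposable q ∨ IrreducibleFamily q) (hc : centralCharge q < 6) :
    chargesOf q ∈ charges21 ∪ charges22 := by
  obtain ⟨m, q', hq', hc', h | h⟩ := irreducible_charges_two hgc hirr
  · exact Or.inl (charges21_eq ▸ ⟨m, q', h, hc'.trans_lt hc, hq'.symm⟩)
  · exact Or.inr (charges22_eq ▸ ⟨m, q', h, hc'.trans_lt hc, hq'.symm⟩)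

theorem charges_three {q : Fin 3 → ℚ} (hgc : GenericallyCompact q)
    (hirr : ¬ Decomposable q ∨ IrreducibleFamily q) (hc : centralCharge q < 6) :
    chargesOf q ∈ charges31 ∪ charges32 ∪ charges33 ∪ charges34 ∪ sporadicCharges := by
  obtain ⟨m, q', hq', h⟩ := irreducible_charges_three hgc hirr hc
  rw [← hq']
  rcases h with h | h | h | h
  · by_cases hm : m ∈ infiniteExponents31
    · exact Or.inl (Or.inl (Or.inl (Or.inl (charges31_of_infinite h hm))))
    · exact Or.inr (sporadic_of_S31 h hm)
  · by_cases hm : m ∈ infiniteExponents32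
    · exact Or.inl (Or.inl (Or.inl (Or.inr (charges32_of_infinite h hm))))
    · exact Or.inr (sporadic_of_S32 h hm)
  · by_cases hm : m ∈ infiniteExponents33
    · exact Or.inl (Or.inl (Or.inr (charges33_of_infinite h hm)))
    · exact Or.inr (sporadic_of_S33 h hm)
  · by_cases hm : m ∈ infiniteExponents34
    · exact Or.inl (Or.inr (charges34_of_infinite h hm))
    · exact Or.inr (sporadic_of_S34 h hm)

end LG

theorem mainTheorem1 :
    -- charges of indecomposable or irreducible generically compact families with `c < 6`
    (∀ q : Fin 1 → ℚ, LG.GenericallyCompact q → (¬ LG.Decomposable q ∨ LG.IrreducibleFamily q) →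
      LG.centralCharge q < 6 → LG.chargesOf q ∈ LG.charges11) ∧
    (∀ q : Fin 2 → ℚ, LG.GenericallyCompact q → (¬ LG.Decomposable q ∨ LG.IrreducibleFamily q) →
      LG.centralCharge q < 6 → LG.chargesOf q ∈ LG.charges21 ∪ LG.charges22) ∧
    (∀ q : Fin 3 → ℚ, LG.GenericallyCompact q → (¬ LG.Decomposable q ∨ LG.IrreducibleFamily q) →
      LG.centralCharge q < 6 →
      LG.chargesOf q ∈
        LG.charges31 ∪ LG.charges32 ∪ LG.charges33 ∪ LG.charges34 ∪ LG.sporadicCharges) ∧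
    -- the listed families come from feasible exponents with `c < 6` on the respective skeletons
    LG.charges11 = LG.feasibleCharges LG.S11 ∧
    LG.charges21 = LG.feasibleCharges LG.S21 ∧
    LG.charges22 = LG.feasibleCharges LG.S22 ∧
    LG.charges31 ⊆ LG.feasibleCharges LG.S31 ∧
    LG.charges32 ⊆ LG.irreducibleChargesOutside LG.S32 ∅ ∧
    LG.charges33 ⊆ LG.feasibleCharges LG.S33 ∧
    LG.charges34 ⊆ LG.irreducibleChargesOutside LG.S34 ∅ ∧
    -- the sporadic charges: exactly 236
    LG.irreducibleChargesOutside LG.S31 LG.infiniteExponents31 ∪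
        LG.irreducibleChargesOutside LG.S32 LG.infiniteExponents32 ∪
        LG.irreducibleChargesOutside LG.S33 LG.infiniteExponents33 ∪
        LG.irreducibleChargesOutside LG.S34 LG.infiniteExponents34 = LG.sporadicCharges ∧
    LG.sporadicCharges.ncard = 236 ∧
    -- the irreducible feasible exponents of `S32`, up to exchanging the two pointers
    (∀ m : Fin 3 → ℕ, m 0 ≤ m 2 →
      ((∃ q, LG.IsIrreducibleExponent LG.S32 m q) ↔
        (∃ s t : ℕ, 1 ≤ t ∧ m = ![2, 4 * t + 3, (2 * s + 1) * (2 * t + 1)]) ∨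
        m = ![3, 7, 4] ∨ m = ![3, 7, 8] ∨ m = ![3, 7, 10] ∨ m = ![3, 13, 4] ∨
          m = ![3, 16, 5])) := by
  exact ⟨fun q hgc hirr _ => LG.charges_one hgc hirr,
    fun q hgc hirr hc => LG.charges_two hgc hirr hc,
    fun q hgc hirr hc => LG.charges_three hgc hirr hc,
    LG.charges11_eq, LG.charges21_eq, LG.charges22_eq, LG.charges31_subset, LG.charges32_subset,
    LG.charges33_subset, LG.charges34_subset, LG.chargesOutside_eq, LG.ncard_sporadicCharges,
    LG.irreducible_S32_iff⟩
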